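/- **Setting.** Let $(M_p)_{p\in\mathbb N}$, $(A_p)_{p\in\mathbb N}$ be sequences of positive numbers with $M_0=M_1=A_0=A_1=1$ such that both are logarithmically convex ($a_p^2\le a_{p-1}a_{p+1}$ for $p\ge 1$) and satisfy $a_p\le c_0H^p\min_{0\le q\le p}a_{p-q}a_q$ for some $c_0,H\ge1$; moreover, for some $s>0$ and $c_0\ge 1$, $\sum_{q\ge p+1}M_{q-1}^s/M_q^s\le c_0\,p\,M_p^s/M_{p+1}^s$ for all $p\ge1$, and $p!\le c_0L_0^pA_p$ for all $p$ and some $c_0,L_0>0$. Put $A(\rho)=\sup_p\ln_+(\rho^p/A_p)$. For $h>0$ let $\mathcal S_h$ be the Banach space of all $\varphi\in C^\infty(\mathbb R^d)$ with $\sigma_h(\varphi)=\sup_\alpha h^{|\alpha|}\|e^{A(h|\cdot|)}D^\alpha\varphi\|_{L^\infty}/M_{|\alpha|}<\infty$. Let $\mathcal S^*_\dagger(\mathbb R^d)$ be either $\varprojlim_{h\to\infty}\mathcal S_h$ (Beurling case) or the locally convex inductive limit $\varinjlim_{h\to0}\mathcal S_h$ (Roumieu case), let $\mathcal S'^*_\dagger(\mathbb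 R^d)$ be its strong dual, and let $T_hf=f(\cdot+h)$, $h\in\mathbb R^d$. The symbol $\hookrightarrow$ denotes a continuous inclusion with dense range. For a Banach space $F$ continuously included in $\mathcal S'^*_\dagger(\mathbb R^d)$ consider the properties * $a')$: $\mathcal S^*_\dagger(\mathbb R^d)\subseteq F$ with continuous inclusion, and $F\hookrightarrow\mathcal S'^*_\dagger(\mathbb R^d)$; * (II): $T_h(F)\subseteq F$ for every $h\in\mathbb R^d$; * $(\widetilde{II})$: each $T_h$, $h\in\mathbb R^d$, is a continuous operator $F\to F$, and for every $g\in F$ the map $h\mapsto T_hg$, $\mathbb R^d\to F$, is continuous; * (III): there are $\tau,C>0$ (Beurling case), respectively for every $\tau>0$ there is $C>0$ (Roumieu case), such that $\|T_hg\|_F\le C\|g\|_Fe^{A(\tau|h|)}$ for all $h\in\mathbb R^d$, $g\in F$. Let $E$ be a complex Banach space with $\mathcal S^*_\dagger(\mathbb R^d)\hookrightarrow E\hookrightarrow\mathcal S'^*_\dagger(\mathbb R^d)$ that satisfies (II) and (III). Its dual $E'$ (with the dual norm) is regarded as a subspace of $\mathcal S'^*_\dagger(\mathbb R^d)$ by restricting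 functionals to $\mathcal S^*_\dagger(\mathbb R^d)$. Let $\omega(h)=\|T_{-h}\|_{\mathcal L(E)}$ and $\check\omega(h)=\|T_{-h}\|_{\mathcal L(E')}=\omega(-h)$. For a weight $\eta$, $L^1_\eta$ is the space of (classes of) measurable functions with $\|u\|_{1,\eta}=\int|u|\,\eta\,dx<\infty$. The convolution of $u\in L^1_\omega$ and $g\in E$ is $u*g=\int_{\mathbb R^d}u(y)\,T_{-y}g\,dy\in E$, and the convolution of $u\in L^1_{\check\omega}$ and $f\in E'$ is the element $u*f\in E'$ given by $\langle u*f,g\rangle=\langle f,\check u*g\rangle$, $g\in E$, where $\check u(x)=u(-x)$. Set $E'_*=L^1_{\check\omega}*E'=\{u*f:\ u\in L^1_{\check\omega},\ f\in E'\}$. **Theorem.** $E'_*$ is a closed linear subspace of $E'$, and, with the norm of $E'$: 1. $E'_*$ has the properties $a')$, $(\widetilde{II})$ and (III). 2. $E'_*$ is a Banach module over the Beurling algebra $L^1_{\check\omega}$ under convolution: $(u,f)\mapsto u*f$ is a bilinear map $L^1_{\check\omega}\times E'_*\to E'_*$ with $\|u*f\|_{E'}\le\|u\|_{1,\check\omega}\|f\|_{E'}$,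 and for $u,v\in L^1_{\check\omega}$ one has $u*v\in L^1_{\check\omega}$ and $(u*v)*f=u*(v*f)$ for all $f\in E'_*$. 3. Let $\varphi\in\mathcal S^*_\dagger(\mathbb R^d)$, $c=\int_{\mathbb R^d}\varphi(x)\,dx$ and $\varphi_\varepsilon(x)=\varepsilon^{-d}\varphi(x/\varepsilon)$. Then $\varphi_\varepsilon\in L^1_{\check\omega}$ for every $\varepsilon>0$, and $\lim_{\varepsilon\to0^+}\|cf-\varphi_\varepsilon*f\|_{E'}=0$ for each $f\in E'_*$. 4. If $E$ is reflexive, then $E'_*=E'$. -/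

import Mathlib

noncomputable section

open MeasureTheory Filter Topology
open scoped ContDiff

namespace UltraTI

/-! ### Weight sequences -/

/-- `(M.1)`: logarithmic convexity. -/
def LogConvexSeq (a : ℕ → ℝ) : Prop :=
  ∀ p, a (p + 1) ^ 2 ≤ a p * a (p + 2)

/-- `(M.2)`: `a_p ≤ c₀ H^p min_{q ≤ p} a_{p-q} a_q` for some constants `c₀, H ≥ 1`. -/
def UltradiffStable (a : ℕ → ℝ) : Prop :=
  ∃ c₀ H : ℝ, 1 ≤ c₀ ∧ 1 ≤ H ∧ ∀ p q, q ≤ p → a p ≤ c₀ * H ^ p * (a (p - q) * a q)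

/-- `(M.5)`: some power `a_p ^ s`, `s > 0`, is strongly non-quasianalytic, i.e.
`∑_{q ≥ p+1} a_{q-1}^s / a_q^s ≤ c₀ p a_p^s / a_{p+1}^s` for all `p ≥ 1`. -/
def PowerStronglyNonQuasianalytic (a : ℕ → ℝ) : Prop :=
  ∃ s : ℝ, 0 < s ∧ ∃ c₀ : ℝ, 1 ≤ c₀ ∧
    Summable (fun q => a q ^ s / a (q + 1) ^ s) ∧
    ∀ p : ℕ, 1 ≤ p →
      ∑' k : ℕ, a (p + k) ^ s / a (p + k + 1) ^ s ≤ c₀ * p * (a p ^ s / a (p + 1) ^ s)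

/-- `(M.6)`: `p! ⊂ a_p`, i.e. `p! ≤ c₀ L₀^p a_p` for some `c₀, L₀ > 0`. -/
def FactorialDominated (a : ℕ → ℝ) : Prop :=
  ∃ c₀ L₀ : ℝ, 0 < c₀ ∧ 0 < L₀ ∧ ∀ p : ℕ, (p.factorial : ℝ) ≤ c₀ * L₀ ^ p * a p

/-- A pair of weight sequences `(M_p)`, `(A_p)` of positive numbers with
`M_0 = M_1 = A_0 = A_1 = 1`, where `M_p` satisfies `(M.1)`, `(M.2)`, `(M.5)` and
`A_p` satisfies `(M.1)`, `(M.2)`, `(M.6)`. -/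
structure WeightPair where
  M : ℕ → ℝ
  A : ℕ → ℝ
  M_pos : ∀ p, 0 < M p
  A_pos : ∀ p, 0 < A p
  M_zero : M 0 = 1
  M_one : M 1 = 1
  A_zero : A 0 = 1
  A_one : A 1 = 1
  M_logConvex : LogConvexSeq M
  A_logConvex : LogConvexSeq A
  M_stable : UltradiffStable M
  A_stable : UltradiffStable A
  M_power : PowerStronglyNonQuasianalytic M
  A_factorial : FactorialDominated A

/-- The Beurling case `(M_p)`-`(A_p)` and the Roumieu case `{M_p}`-`{A_p}`. -/
inductive UltraCase
  | beurling
  | roumieu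

/-- The associated function `A(ρ) = sup_p ln₊ (ρ^p / A_p)` of the sequence `A_p`. -/
def WeightPair.assoc (W : WeightPair) (ρ : ℝ) : ℝ :=
  ⨆ p : ℕ, Real.posLog (ρ ^ p / W.A p)

lemma WeightPair.assoc_bdd (W : WeightPair) (ρ : ℝ) :
    BddAbove (Set.range fun p : ℕ => Real.posLog (ρ ^ p / W.A p)) := by
  obtain ⟨c, L, hc, hL, h⟩ := W.A_factorial
  refine ⟨Real.posLog (c * Real.exp (L * |ρ|)), ?_⟩
  rintro _ ⟨p, rfl⟩
  have hA := W.A_pos p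
  dsimp only
  rw [← Real.posLog_abs (ρ ^ p / W.A p)]
  refine Real.posLog_le_posLog (abs_nonneg _) ?_
  rw [abs_div, abs_pow, abs_of_pos hA, div_le_iff₀ hA]
  have h1 : (L * |ρ|) ^ p / (p.factorial : ℝ) ≤ Real.exp (L * |ρ|) :=
    Real.pow_div_factorial_le_exp _ (by positivity) p
  have hf : (0 : ℝ) < p.factorial := by exact_mod_cast p.factorial_pos
  rw [div_le_iff₀ hf, mul_pow] at h1
  have hLp : 0 < L ^ p := by positivity
  have h2 : L ^ p * |ρ| ^ p ≤ L ^ p * (c * Real.exp (L * |ρ|) * W.A p) := by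
    calc _ ≤ Real.exp (L * |ρ|) * p.factorial := h1
      _ ≤ Real.exp (L * |ρ|) * (c * L ^ p * W.A p) := by gcongr; exact h p
      _ = _ := by ring
  exact le_of_mul_le_mul_left h2 hLp

lemma WeightPair.assoc_nonneg (W : WeightPair) (ρ : ℝ) : 0 ≤ W.assoc ρ :=
  Real.iSup_nonneg fun _ => Real.posLog_nonneg

lemma WeightPair.assoc_mono (W : WeightPair) {ρ μ : ℝ} (hρ : 0 ≤ ρ) (h : ρ ≤ μ) :
    W.assoc ρ ≤ W.assoc μ := by
  refine ciSup_mono (W.assoc_bdd μ) fun p => Real.posLog_le_posLog ?_ ?_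
  · have := W.A_pos p
    positivity
  · have := W.A_pos p
    gcongr

lemma WeightPair.assoc_add_le (W : WeightPair) {ρ μ : ℝ} (hρ : 0 ≤ ρ) (hμ : 0 ≤ μ) :
    W.assoc (ρ + μ) ≤ W.assoc (2 * ρ) + W.assoc (2 * μ) := by
  rcases le_total ρ μ with h | h
  · have := W.assoc_mono (ρ := ρ + μ) (μ := 2 * μ) (by positivity) (by linarith)
    linarith [W.assoc_nonneg (2 * ρ)]
  · have := W.assoc_mono (ρ := ρ + μ) (μ := 2 * ρ) (by positivity) (by linarith)
    linarith [W.assoc_nonneg (2 * μ)]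

/-! ### The test function spaces -/

/-- `ℝ^d` with its Euclidean norm. -/
abbrev Rd (d : ℕ) : Type := EuclideanSpace ℝ (Fin d)

/-- The partial derivative `∂_{s 0} ⋯ ∂_{s (n-1)} φ (x)`. For smooth `φ`, as `s` runs over all
maps `Fin n → Fin d`, these are exactly the derivatives `∂^α φ (x)` with `|α| = n`. -/
def partialD {d : ℕ} (φ : Rd d → ℂ) {n : ℕ} (s : Fin n → Fin d) (x : Rd d) : ℂ :=
  iteratedFDeriv ℝ n φ x fun i => EuclideanSpace.single (s i) 1

/-- The quantity `h^{|α|} e^{A(h|x|)} |D^α φ(x)| / M_α`, where `i = (α, x)` and `M_α = M_{|α|}`. -/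
def stepTerm (W : WeightPair) {d : ℕ} (h : ℝ) (φ : Rd d → ℂ)
    (i : (Σ n : ℕ, Fin n → Fin d) × Rd d) : ℝ :=
  h ^ i.1.1 * (Real.exp (W.assoc (h * ‖i.2‖)) * ‖partialD φ i.1.2 i.2‖) / W.M i.1.1

/-- The norm `σ_h(φ) = sup_α h^{|α|} ‖e^{A(h|·|)} D^α φ‖_∞ / M_α`. -/
def sigma (W : WeightPair) {d : ℕ} (h : ℝ) (φ : Rd d → ℂ) : ℝ :=
  ⨆ i, stepTerm W h φ i

lemma partialD_add {d : ℕ} {φ ψ : Rd d → ℂ} (hφ : ContDiff ℝ ∞ φ) (hψ : ContDiff ℝ ∞ ψ)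
    {n : ℕ} (s : Fin n → Fin d) (x : Rd d) :
    partialD (φ + ψ) s x = partialD φ s x + partialD ψ s x := by
  unfold partialD
  rw [iteratedFDeriv_add_apply (hφ.contDiffAt.of_le (by exact_mod_cast le_top))
    (hψ.contDiffAt.of_le (by exact_mod_cast le_top))]
  rfl

lemma partialD_smul {d : ℕ} {φ : Rd d → ℂ} (hφ : ContDiff ℝ ∞ φ) (a : ℂ)
    {n : ℕ} (s : Fin n → Fin d) (x : Rd d) :
    partialD (a • φ) s x = a * partialD φ s x := by
  unfold partialD
  rw [iteratedFDeriv_const_smul_apply (hφ.contDiffAt.of_le (by exact_mod_cast le_top))]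
  rfl

lemma partialD_shift {d : ℕ} (φ : Rd d → ℂ) (h : Rd d) {n : ℕ} (s : Fin n → Fin d) (x : Rd d) :
    partialD (fun y => φ (y + h)) s x = partialD φ s (x + h) := by
  unfold partialD
  rw [iteratedFDeriv_comp_add_right]

lemma stepTerm_nonneg (W : WeightPair) {d : ℕ} {h : ℝ} (hh : 0 < h) (φ : Rd d → ℂ)
    (i : (Σ n : ℕ, Fin n → Fin d) × Rd d) : 0 ≤ stepTerm W h φ i := by
  have := W.M_pos i.1.1
  unfold stepTerm
  positivity

lemma stepTerm_add_le (W : WeightPair) {d : ℕ} {h : ℝ} (hh : 0 < h) {φ ψ : Rd d → ℂ}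
    (hφ : ContDiff ℝ ∞ φ) (hψ : ContDiff ℝ ∞ ψ) (i : (Σ n : ℕ, Fin n → Fin d) × Rd d) :
    stepTerm W h (φ + ψ) i ≤ stepTerm W h φ i + stepTerm W h ψ i := by
  have := W.M_pos i.1.1
  unfold stepTerm
  rw [partialD_add hφ hψ, ← add_div, ← mul_add, ← mul_add]
  gcongr
  exact norm_add_le _ _

lemma stepTerm_smul (W : WeightPair) {d : ℕ} (h : ℝ) {φ : Rd d → ℂ}
    (hφ : ContDiff ℝ ∞ φ) (a : ℂ) (i : (Σ n : ℕ, Fin n → Fin d) × Rd d) :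
    stepTerm W h (a • φ) i = ‖a‖ * stepTerm W h φ i := by
  unfold stepTerm
  rw [partialD_smul hφ, norm_mul]
  ring

/-- The Banach space `S^{M_p,h}_{A_p,h}` (as a vector space), `h > 0`: all smooth functions
with finite `σ_h`. -/
def step (W : WeightPair) (d : ℕ) (h : Set.Ioi (0 : ℝ)) : Submodule ℂ (Rd d → ℂ) where
  carrier := {φ | ContDiff ℝ ∞ φ ∧ BddAbove (Set.range (stepTerm W h φ))}
  zero_mem' := by
    refine ⟨contDiff_const, 0, ?_⟩
    rintro _ ⟨i, rfl⟩
    have : partialD (0 : Rd d → ℂ) i.1.2 i.2 = 0 := by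
      unfold partialD
      simp
    simp [stepTerm, this]
  add_mem' := by
    rintro φ ψ ⟨hφ, C, hC⟩ ⟨hψ, D, hD⟩
    refine ⟨hφ.add hψ, C + D, ?_⟩
    rintro _ ⟨i, rfl⟩
    exact (stepTerm_add_le W h.2 hφ hψ i).trans
      (add_le_add (hC ⟨i, rfl⟩) (hD ⟨i, rfl⟩))
  smul_mem' := by
    rintro a φ ⟨hφ, C, hC⟩
    refine ⟨hφ.const_smul a, ‖a‖ * C, ?_⟩
    rintro _ ⟨i, rfl⟩
    rw [stepTerm_smul W _ hφ]
    exact mul_le_mul_of_nonneg_left (hC ⟨i, rfl⟩) (norm_nonneg a)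

/-- The vector space underlying `S^*_†(ℝ^d)`: the intersection of all the spaces
`S^{M_p,h}_{A_p,h}`, `h > 0`, in the Beurling case and their (directed) union in the Roumieu
case. -/
def testSubmodule (W : WeightPair) (d : ℕ) : UltraCase → Submodule ℂ (Rd d → ℂ)
  | .beurling => ⨅ h, step W d h
  | .roumieu => ⨆ h, step W d h

/-- The test function space `S^*_†(ℝ^d)`. It is a type of its own, since it does not carry the
topology of pointwise convergence. -/
def TestSpace (W : WeightPair) (c : UltraCase) (d : ℕ) : Type :=
  testSubmodule W d c

namespace TestSpace

variable {W : WeightPair} {c : UltraCase} {d : ℕ}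

instance : AddCommGroup (TestSpace W c d) := inferInstanceAs (AddCommGroup (testSubmodule W d c))

instance : Module ℂ (TestSpace W c d) := inferInstanceAs (Module ℂ (testSubmodule W d c))

instance : CoeFun (TestSpace W c d) fun _ => Rd d → ℂ := ⟨fun φ => φ.1⟩

/-- The continuous seminorms of `S^*_†(ℝ^d)`. In the Beurling case (projective limit of the
spaces `S^{M_p,h}_{A_p,h}`) they are those dominated by a multiple of some `σ_h`; in the Roumieu
case (locally convex inductive limit) they are those whose restriction to every
`S^{M_p,h}_{A_p,h}` is dominated by a multiple of `σ_h`. -/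
def IsContSeminorm : (c : UltraCase) → Seminorm ℂ (TestSpace W c d) → Prop
  | .beurling, p => ∃ (h : Set.Ioi (0 : ℝ)) (C : ℝ), ∀ φ, p φ ≤ C * sigma W h φ.1
  | .roumieu, p => ∀ h : Set.Ioi (0 : ℝ), ∃ C : ℝ, ∀ φ, φ.1 ∈ step W d h → p φ ≤ C * sigma W h φ.1

/-- The family of all seminorms that define the topology of `S^*_†(ℝ^d)`. -/
def seminormFamily (W : WeightPair) (c : UltraCase) (d : ℕ) :
    SeminormFamily ℂ (TestSpace W c d) {p : Seminorm ℂ (TestSpace W c d) // IsContSeminorm c p} :=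
  fun p => p.1

/-- The locally convex topology of `S^*_†(ℝ^d)`. -/
instance : TopologicalSpace (TestSpace W c d) :=
  (seminormFamily W c d).moduleFilterBasis.topology

lemma withSeminorms : WithSeminorms (seminormFamily W c d) := ⟨rfl⟩

instance : IsTopologicalAddGroup (TestSpace W c d) := withSeminorms.topologicalAddGroup

instance : ContinuousSMul ℂ (TestSpace W c d) := withSeminorms.continuousSMul

end TestSpace

/-! ### Translations -/

lemma stepTerm_le_sigma (W : WeightPair) {d : ℕ} {h : Set.Ioi (0 : ℝ)} {φ : Rd d → ℂ}
    (hφ : φ ∈ step W d h) (i) : stepTerm W h φ i ≤ sigma W h φ :=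
  le_ciSup hφ.2 i

lemma sigma_nonneg (W : WeightPair) {d : ℕ} (h : Set.Ioi (0 : ℝ)) (φ : Rd d → ℂ) :
    0 ≤ sigma W h φ :=
  Real.iSup_nonneg fun i => stepTerm_nonneg W h.2 φ i

lemma step_antitone (W : WeightPair) (d : ℕ) : Antitone (step W d) := by
  rintro h k hhk φ ⟨hφ, C, hC⟩
  refine ⟨hφ, C, ?_⟩
  rintro _ ⟨i, rfl⟩
  refine le_trans ?_ (hC ⟨i, rfl⟩)
  have := W.M_pos i.1.1
  have h0 : (0 : ℝ) < h := h.2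
  have hk : (h : ℝ) ≤ k := hhk
  unfold stepTerm
  have hk0 : (0 : ℝ) < k := k.2
  have hA : W.assoc (h * ‖i.2‖) ≤ W.assoc (k * ‖i.2‖) :=
    W.assoc_mono (by positivity) (by gcongr)
  gcongr

lemma mem_roumieu_iff (W : WeightPair) (d : ℕ) (φ : Rd d → ℂ) :
    φ ∈ testSubmodule W d .roumieu ↔ ∃ h, φ ∈ step W d h :=
  Submodule.mem_iSup_of_directed _ (step_antitone W d).directed_le

/-- The index `h / r`. -/
def divIdx (h : Set.Ioi (0 : ℝ)) (r : ℝ) (hr : 0 < r) : Set.Ioi (0 : ℝ) :=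
  ⟨h / r, div_pos h.2 hr⟩

lemma stepTerm_shift_le (W : WeightPair) {d : ℕ} (h : Set.Ioi (0 : ℝ)) (φ : Rd d → ℂ)
    (y : Rd d) (i : (Σ n : ℕ, Fin n → Fin d) × Rd d) :
    stepTerm W (divIdx h 2 two_pos) (fun x => φ (x + y)) i ≤
      Real.exp (W.assoc (h * ‖y‖)) * stepTerm W h φ (i.1, i.2 + y) := by
  have hM := W.M_pos i.1.1
  have h0 : (0 : ℝ) < h := h.2
  unfold stepTerm
  rw [partialD_shift]
  have h1 : Real.exp (W.assoc ((divIdx h 2 two_pos : ℝ) * ‖i.2‖)) ≤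
      Real.exp (W.assoc (h * ‖y‖)) * Real.exp (W.assoc (h * ‖i.2 + y‖)) := by
    rw [← Real.exp_add]
    refine Real.exp_le_exp.2 ?_
    have h2 : ‖i.2‖ ≤ ‖y‖ + ‖i.2 + y‖ := by
      have := norm_sub_le (i.2 + y) y
      rw [add_sub_cancel_right] at this
      linarith
    have h3 := W.assoc_add_le (ρ := h / 2 * ‖y‖) (μ := h / 2 * ‖i.2 + y‖)
      (by positivity) (by positivity)
    have h4 : W.assoc ((h : ℝ) / 2 * ‖i.2‖) ≤ W.assoc (h / 2 * ‖y‖ + h / 2 * ‖i.2 + y‖) :=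
      W.assoc_mono (by positivity) (by rw [← mul_add]; gcongr)
    rw [show 2 * ((h : ℝ) / 2 * ‖y‖) = h * ‖y‖ by ring,
      show 2 * ((h : ℝ) / 2 * ‖i.2 + y‖) = h * ‖i.2 + y‖ by ring] at h3
    exact h4.trans h3
  have h5 : (divIdx h 2 two_pos : ℝ) ^ i.1.1 ≤ (h : ℝ) ^ i.1.1 := by
    have : (divIdx h 2 two_pos : ℝ) = h / 2 := rfl
    rw [this]
    gcongr
    linarith
  have h6 : (0 : ℝ) < divIdx h 2 two_pos := (divIdx h 2 two_pos).2
  rw [← mul_div_assoc]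
  refine div_le_div_of_nonneg_right ?_ hM.le
  calc _ ≤ (h : ℝ) ^ i.1.1 * (Real.exp (W.assoc (h * ‖y‖)) * Real.exp (W.assoc (h * ‖i.2 + y‖)) *
        ‖partialD φ i.1.2 (i.2 + y)‖) := by gcongr
    _ = _ := by ring

lemma shift_mem_step (W : WeightPair) {d : ℕ} {h : Set.Ioi (0 : ℝ)} {φ : Rd d → ℂ}
    (hφ : φ ∈ step W d h) (y : Rd d) :
    (fun x => φ (x + y)) ∈ step W d (divIdx h 2 two_pos) := by
  refine ⟨hφ.1.comp (contDiff_id.add contDiff_const),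
    Real.exp (W.assoc (h * ‖y‖)) * sigma W h φ, ?_⟩
  rintro _ ⟨i, rfl⟩
  refine (stepTerm_shift_le W h φ y i).trans ?_
  exact mul_le_mul_of_nonneg_left (stepTerm_le_sigma W hφ _) (Real.exp_pos _).le

lemma sigma_shift_le (W : WeightPair) {d : ℕ} {h : Set.Ioi (0 : ℝ)} {φ : Rd d → ℂ}
    (hφ : φ ∈ step W d h) (y : Rd d) :
    sigma W (divIdx h 2 two_pos) (fun x => φ (x + y)) ≤
      Real.exp (W.assoc (h * ‖y‖)) * sigma W h φ := by
  refine Real.iSup_le (fun i => (stepTerm_shift_le W h φ y i).trans ?_) ?_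
  · exact mul_le_mul_of_nonneg_left (stepTerm_le_sigma W hφ _) (Real.exp_pos _).le
  · exact mul_nonneg (Real.exp_pos _).le (sigma_nonneg W h φ)

/-- The index `h * r`. -/
def mulIdx (h : Set.Ioi (0 : ℝ)) (r : ℝ) (hr : 0 < r) : Set.Ioi (0 : ℝ) :=
  ⟨h * r, mul_pos h.2 hr⟩

lemma divIdx_mulIdx (h : Set.Ioi (0 : ℝ)) (r : ℝ) (hr : 0 < r) :
    divIdx (mulIdx h r hr) r hr = h :=
  Subtype.ext (mul_div_cancel_right₀ _ hr.ne')

lemma shift_mem (W : WeightPair) {d : ℕ} (c : UltraCase) {φ : Rd d → ℂ}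
    (hφ : φ ∈ testSubmodule W d c) (y : Rd d) :
    (fun x => φ (x + y)) ∈ testSubmodule W d c := by
  cases c with
  | beurling =>
    refine Submodule.mem_iInf _ |>.2 fun h => ?_
    have := shift_mem_step W ((Submodule.mem_iInf _).1 hφ (mulIdx h 2 two_pos)) y
    rwa [divIdx_mulIdx] at this
  | roumieu =>
    obtain ⟨h, hh⟩ := (mem_roumieu_iff W d φ).1 hφ
    exact (mem_roumieu_iff W d _).2 ⟨_, shift_mem_step W hh y⟩

namespace TestSpace

variable {W : WeightPair} {c : UltraCase} {d : ℕ}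

/-- The translation `T_h φ = φ(· + h)` on `S^*_†(ℝ^d)`, as a linear map. -/
def translateₗ (W : WeightPair) (c : UltraCase) {d : ℕ} (h : Rd d) :
    TestSpace W c d →ₗ[ℂ] TestSpace W c d where
  toFun φ := ⟨fun x => φ (x + h), shift_mem W c φ.2 h⟩
  map_add' _ _ := rfl
  map_smul' _ _ := rfl

lemma isContSeminorm_comp_translate (p : Seminorm ℂ (TestSpace W c d)) (hp : IsContSeminorm c p)
    (y : Rd d) : IsContSeminorm c (p.comp (translateₗ W c y)) := by
  cases c with
  | beurling =>
    obtain ⟨h, C, hC⟩ := hp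
    refine ⟨mulIdx h 2 two_pos, |C| * Real.exp (W.assoc (mulIdx h 2 two_pos * ‖y‖)), fun φ => ?_⟩
    have h1 := sigma_shift_le W ((Submodule.mem_iInf _).1 φ.2 (mulIdx h 2 two_pos)) y
    rw [divIdx_mulIdx] at h1
    rw [mul_assoc]
    refine (hC _).trans ((mul_le_mul_of_nonneg_right (le_abs_self C) (sigma_nonneg W h _)).trans ?_)
    exact mul_le_mul_of_nonneg_left h1 (abs_nonneg C)
  | roumieu =>
    intro h
    obtain ⟨C, hC⟩ := hp (divIdx h 2 two_pos)
    refine ⟨|C| * Real.exp (W.assoc (h * ‖y‖)), fun φ hφ => ?_⟩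
    rw [mul_assoc]
    refine (hC _ (shift_mem_step W hφ y)).trans
      ((mul_le_mul_of_nonneg_right (le_abs_self C) (sigma_nonneg W _ _)).trans ?_)
    exact mul_le_mul_of_nonneg_left (sigma_shift_le W hφ y) (abs_nonneg C)

/-- The translation `T_h φ = φ(· + h)` on `S^*_†(ℝ^d)`. -/
def translate (W : WeightPair) (c : UltraCase) {d : ℕ} (h : Rd d) :
    TestSpace W c d →L[ℂ] TestSpace W c d where
  toLinearMap := translateₗ W c h
  cont := withSeminorms.continuous_of_continuous_comp _ fun p =>
    withSeminorms.continuous_seminorm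
      ⟨p.1.comp (translateₗ W c h), isContSeminorm_comp_translate p.1 p.2 h⟩

@[simp] lemma translate_apply (h : Rd d) (φ : TestSpace W c d) (x : Rd d) :
    translate W c h φ x = φ (x + h) := rfl

end TestSpace

lemma norm_partialD_sub_le (W : WeightPair) {d : ℕ} {h : Set.Ioi (0 : ℝ)} {φ : Rd d → ℂ}
    (hφ : φ ∈ step W d h) {n : ℕ} (s : Fin n → Fin d) (x y : Rd d) (hy : ‖y‖ ≤ 1) :
    ‖partialD φ s (x + y) - partialD φ s x‖ ≤
      d * (sigma W h φ * W.M (n + 1) / (h : ℝ) ^ (n + 1) *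
        (Real.exp (W.assoc h) / Real.exp (W.assoc (h / 2 * ‖x‖)))) * ‖y‖ := by
  have h0 : (0 : ℝ) < h := h.2
  have hdiff : Differentiable ℝ (iteratedFDeriv ℝ n φ) :=
    hφ.1.differentiable_iteratedFDeriv (by exact_mod_cast WithTop.coe_lt_top n)
  have key := (convex_closedBall x ‖y‖).norm_image_sub_le_of_norm_fderiv_le (𝕜 := ℝ)
    (f := partialD φ s) (x := x) (y := x + y)
    (C := d * (sigma W h φ * W.M (n + 1) / (h : ℝ) ^ (n + 1) *
        (Real.exp (W.assoc h) / Real.exp (W.assoc (h / 2 * ‖x‖)))))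
    (fun z _ => ?_) (fun z hz => ?_) (by simp) (by simp)
  · simpa using key
  · exact ((hdiff z).continuousMultilinear_apply_const _)
  · have hM := W.M_pos (n + 1)
    have hB : 0 ≤ sigma W h φ * W.M (n + 1) / (h : ℝ) ^ (n + 1) *
        (Real.exp (W.assoc h) / Real.exp (W.assoc (h / 2 * ‖x‖))) := by
      have := sigma_nonneg W h φ
      positivity
    refine ContinuousLinearMap.opNorm_le_bound _ (by positivity) fun v => ?_
    have hv : fderiv ℝ (partialD φ s) z v = ∑ j, v j • partialD φ (Fin.cons j s : Fin (n + 1) → Fin d) z := by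
      have e1 : v = ∑ j, v j • EuclideanSpace.single j (1 : ℝ) := by
        ext k
        simp [Pi.single_apply]
      conv_lhs => rw [e1]
      rw [map_sum]
      refine Finset.sum_congr rfl fun j _ => ?_
      rw [map_smul]
      congr 1
      unfold partialD
      rw [DifferentiableAt.iteratedFDeriv_succ_apply_left' (hdiff z)]
      rfl
    rw [hv]
    refine (norm_sum_le _ _).trans ?_
    have hj : ∀ j ∈ Finset.univ, ‖v j • partialD φ (Fin.cons j s : Fin (n + 1) → Fin d) z‖ ≤
        (sigma W h φ * W.M (n + 1) / (h : ℝ) ^ (n + 1) *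
        (Real.exp (W.assoc h) / Real.exp (W.assoc (h / 2 * ‖x‖)))) * ‖v‖ := by
      intro j _
      rw [norm_smul, mul_comm]
      refine mul_le_mul ?_ (PiLp.norm_apply_le v j) (norm_nonneg _) hB
      have h1 := stepTerm_le_sigma W hφ (⟨n + 1, Fin.cons j s⟩, z)
      unfold stepTerm at h1
      dsimp only at h1
      rw [div_le_iff₀ hM] at h1
      have h2 : Real.exp (W.assoc (h / 2 * ‖x‖)) ≤
          Real.exp (W.assoc h) * Real.exp (W.assoc (h * ‖z‖)) := by
        rw [← Real.exp_add]
        refine Real.exp_le_exp.2 ?_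
        have h3 : ‖x‖ ≤ 1 + ‖z‖ := by
          have h4 : ‖x - z‖ ≤ 1 := by
            rw [← dist_eq_norm, dist_comm]
            exact (Metric.mem_closedBall.1 hz).trans hy
          have := norm_le_norm_sub_add x z
          linarith
        have h5 := W.assoc_add_le (ρ := h / 2) (μ := h / 2 * ‖z‖) (by positivity) (by positivity)
        have h6 : W.assoc ((h : ℝ) / 2 * ‖x‖) ≤ W.assoc (h / 2 + h / 2 * ‖z‖) :=
          W.assoc_mono (by positivity) (by nlinarith)
        rw [show 2 * ((h : ℝ) / 2) = h by ring,
          show 2 * ((h : ℝ) / 2 * ‖z‖) = h * ‖z‖ by ring] at h5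
        exact h6.trans h5
      rw [← mul_div_assoc (sigma W h φ * W.M (n + 1) / (h : ℝ) ^ (n + 1)),
        le_div_iff₀ (Real.exp_pos _), div_mul_eq_mul_div (sigma W h φ * W.M (n + 1)), le_div_iff₀ (by positivity)]
      calc _ ≤ ‖partialD φ (Fin.cons j s : Fin (n + 1) → Fin d) z‖ *
              (Real.exp (W.assoc h) * Real.exp (W.assoc (h * ‖z‖))) * (h : ℝ) ^ (n + 1) := by
            gcongr
        _ = ((h : ℝ) ^ (n + 1) * (Real.exp (W.assoc (h * ‖z‖)) *
              ‖partialD φ (Fin.cons j s : Fin (n + 1) → Fin d) z‖)) * Real.exp (W.assoc h) := by ring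
        _ ≤ _ := by gcongr
    refine (Finset.sum_le_sum hj).trans ?_
    simp [mul_assoc]

lemma partialD_sub {d : ℕ} {φ ψ : Rd d → ℂ} (hφ : ContDiff ℝ ∞ φ) (hψ : ContDiff ℝ ∞ ψ)
    {n : ℕ} (s : Fin n → Fin d) (x : Rd d) :
    partialD (φ - ψ) s x = partialD φ s x - partialD ψ s x := by
  unfold partialD
  rw [iteratedFDeriv_sub_apply (hφ.contDiffAt.of_le (by exact_mod_cast le_top))
    (hψ.contDiffAt.of_le (by exact_mod_cast le_top))]
  rfl

lemma exists_sigma_shift_sub_le (W : WeightPair) (d : ℕ) :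
    ∃ (r : ℝ) (hr : 0 < r), ∀ h : Set.Ioi (0 : ℝ), ∃ K : ℝ, 0 ≤ K ∧ ∀ φ : Rd d → ℂ,
      φ ∈ step W d h → ∀ y : Rd d, ‖y‖ ≤ 1 →
        ((fun x => φ (x + y)) - φ) ∈ step W d (divIdx h r hr) ∧
        sigma W (divIdx h r hr) ((fun x => φ (x + y)) - φ) ≤ K * ‖y‖ * sigma W h φ := by
  obtain ⟨c₀, H, hc, hH, hst⟩ := W.M_stable
  have hH0 : 0 < H := by linarith
  refine ⟨2 * H, by positivity, fun h => ?_⟩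
  have h0 : (0 : ℝ) < h := h.2
  have hc0 : 0 < c₀ := by linarith
  refine ⟨d * c₀ * (H / h) * Real.exp (W.assoc h), by positivity, fun φ hφ y hy => ?_⟩
  have hsm : ContDiff ℝ ∞ fun x => φ (x + y) := hφ.1.comp (contDiff_id.add contDiff_const)
  have hs := sigma_nonneg W h φ
  have key : ∀ i, stepTerm W (divIdx h (2 * H) (by positivity)) ((fun x => φ (x + y)) - φ) i ≤
      d * c₀ * (H / h) * Real.exp (W.assoc h) * ‖y‖ * sigma W h φ := by
    rintro ⟨⟨n, s⟩, x⟩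
    have hM := W.M_pos n
    have hM1 := W.M_pos (n + 1)
    unfold stepTerm
    dsimp only
    rw [partialD_sub hsm hφ.1, partialD_shift, div_le_iff₀ hM]
    have hk : (divIdx h (2 * H) (by positivity) : ℝ) = h / (2 * H) := rfl
    rw [hk]
    have e1 := norm_partialD_sub_le W hφ s x y hy
    have e2 : Real.exp (W.assoc (h / (2 * H) * ‖x‖)) ≤ Real.exp (W.assoc (h / 2 * ‖x‖)) := by
      refine Real.exp_le_exp.2 (W.assoc_mono (by positivity) ?_)
      gcongr
      linarith
    have e3 : W.M (n + 1) ≤ c₀ * H ^ (n + 1) * W.M n := by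
      have := hst (n + 1) 1 (by omega)
      simpa [W.M_one] using this
    have e4 : ((h : ℝ) / (2 * H)) ^ n * (H ^ (n + 1) / (h : ℝ) ^ (n + 1)) ≤ H / h := by
      have : ((h : ℝ) / (2 * H)) ^ n * (H ^ (n + 1) / (h : ℝ) ^ (n + 1)) =
          (1 / 2) ^ n * (H / h) := by
        rw [div_pow, mul_pow, pow_succ, pow_succ, one_div, inv_pow]
        field_simp
      rw [this]
      exact mul_le_of_le_one_left (by positivity) (pow_le_one₀ (by norm_num) (by norm_num))
    have hE := Real.exp_pos (W.assoc (h / 2 * ‖x‖))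
    calc (h / (2 * H) : ℝ) ^ n * (Real.exp (W.assoc (h / (2 * H) * ‖x‖)) *
          ‖partialD φ s (x + y) - partialD φ s x‖)
        ≤ (h / (2 * H) : ℝ) ^ n * (Real.exp (W.assoc (h / 2 * ‖x‖)) *
          (d * (sigma W h φ * (c₀ * H ^ (n + 1) * W.M n) / (h : ℝ) ^ (n + 1) *
          (Real.exp (W.assoc h) / Real.exp (W.assoc (h / 2 * ‖x‖)))) * ‖y‖)) := by
          gcongr
          exact e1.trans (by gcongr)
      _ = ((h / (2 * H) : ℝ) ^ n * (H ^ (n + 1) / (h : ℝ) ^ (n + 1))) *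
          (d * c₀ * Real.exp (W.assoc h) * ‖y‖ * sigma W h φ * W.M n) := by
          field_simp
      _ ≤ (H / h) * (d * c₀ * Real.exp (W.assoc h) * ‖y‖ * sigma W h φ * W.M n) := by
          gcongr
      _ = _ := by ring
  exact ⟨⟨hsm.sub hφ.1, _, by rintro _ ⟨i, rfl⟩; exact key i⟩,
    Real.iSup_le key (by positivity)⟩

namespace TestSpace

variable {W : WeightPair} {c : UltraCase} {d : ℕ}

/-- Translation is strongly continuous on `S^*_†(ℝ^d)`. -/
lemma tendsto_translate (φ : TestSpace W c d) :
    Tendsto (fun y : Rd d => translate W c y φ) (𝓝 0) (𝓝 φ) := by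
  rw [withSeminorms.tendsto_nhds]
  rintro ⟨p, hp⟩ ε hε
  obtain ⟨r, hr, hK⟩ := exists_sigma_shift_sub_le W d
  have main : ∃ C : ℝ, ∀ y : Rd d, ‖y‖ ≤ 1 → p (translate W c y φ - φ) ≤ C * ‖y‖ := by
    cases c with
    | beurling =>
      obtain ⟨h, C, hC⟩ := hp
      obtain ⟨K, hK0, hK⟩ := hK (mulIdx h r hr)
      refine ⟨|C| * (K * sigma W (mulIdx h r hr) φ.1), fun y hy => ?_⟩
      have h1 := (hK φ.1 ((Submodule.mem_iInf _).1 φ.2 _) y hy).2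
      rw [divIdx_mulIdx] at h1
      refine (hC _).trans
        ((mul_le_mul_of_nonneg_right (le_abs_self C) (sigma_nonneg W h _)).trans ?_)
      refine (mul_le_mul_of_nonneg_left h1 (abs_nonneg C)).trans (le_of_eq (by ring))
    | roumieu =>
      obtain ⟨h, hφ⟩ := (mem_roumieu_iff W d _).1 φ.2
      obtain ⟨C, hC⟩ := hp (divIdx h r hr)
      obtain ⟨K, hK0, hK⟩ := hK h
      refine ⟨|C| * (K * sigma W h φ.1), fun y hy => ?_⟩
      have h1 := hK φ.1 hφ y hy
      refine (hC _ h1.1).trans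
        ((mul_le_mul_of_nonneg_right (le_abs_self C) (sigma_nonneg W _ _)).trans ?_)
      refine (mul_le_mul_of_nonneg_left h1.2 (abs_nonneg C)).trans (le_of_eq (by ring))
  obtain ⟨C, hC⟩ := main
  have hlim : Tendsto (fun y : Rd d => C * ‖y‖) (𝓝 0) (𝓝 0) := by
    have : Continuous fun y : Rd d => C * ‖y‖ := by fun_prop
    simpa using this.tendsto 0
  filter_upwards [hlim.eventually (gt_mem_nhds hε), Metric.closedBall_mem_nhds (0 : Rd d) one_pos]
    with y h1 h2
  exact (hC y (by simpa using h2)).trans_lt h1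

end TestSpace

/-! ### Ultradistributions and translation-invariant Banach spaces -/

/-- The space `S'^*_†(ℝ^d)`, with the strong dual topology. -/
abbrev Ultradistribution (W : WeightPair) (c : UltraCase) (d : ℕ) : Type :=
  TestSpace W c d →L[ℂ] ℂ

/-- The translation `T_h f = f(· + h)` of ultradistributions, `⟨T_h f, φ⟩ = ⟨f, T_{-h} φ⟩`. -/
def translateDual (W : WeightPair) (c : UltraCase) {d : ℕ} (h : Rd d) :
    Ultradistribution W c d →L[ℂ] Ultradistribution W c d :=
  ContinuousLinearMap.precomp ℂ (TestSpace.translate W c (-h))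

section Axioms

variable {W : WeightPair} {c : UltraCase} {d : ℕ}
  {F : Type*} [NormedAddCommGroup F] [NormedSpace ℂ F]

/-- `(II)`: `T_h F ⊆ F` for all `h`, for a space `F` embedded into `S'^*_†(ℝ^d)` by `emb`. -/
def AxiomII (emb : F →L[ℂ] Ultradistribution W c d) : Prop :=
  ∀ (h : Rd d) (g : F), ∃ g' : F, emb g' = translateDual W c h (emb g)

/-- The estimate `‖T_h g‖ ≤ C ‖g‖ e^{A(τ|h|)}` for all `h ∈ ℝ^d` and `g ∈ F`. -/
def TranslationBound (emb : F →L[ℂ] Ultradistribution W c d) (τ C : ℝ) : Prop :=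
  ∀ (h : Rd d) (g g' : F), emb g' = translateDual W c h (emb g) →
    ‖g'‖ ≤ C * ‖g‖ * Real.exp (W.assoc (τ * ‖h‖))

/-- `(III)`: in the Beurling case there are `τ, C > 0`, in the Roumieu case for every `τ > 0`
there is `C > 0`, such that `‖T_h g‖ ≤ C ‖g‖ e^{A(τ|h|)}` for all `h` and `g`. -/
def AxiomIII (emb : F →L[ℂ] Ultradistribution W c d) : Prop :=
  match c with
  | .beurling => ∃ τ : ℝ, 0 < τ ∧ ∃ C : ℝ, 0 < C ∧ TranslationBound emb τ C
  | .roumieu => ∀ τ : ℝ, 0 < τ → ∃ C : ℝ, 0 < C ∧ TranslationBound emb τ C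

/-- `(II~)`: the translations act on `F` by continuous operators `T_h : F → F`, and
`h ↦ T_h g` is continuous from `ℝ^d` to `F` for every `g`. -/
def AxiomIIStrong (emb : F →L[ℂ] Ultradistribution W c d) : Prop :=
  ∃ T : Rd d → F →L[ℂ] F,
    (∀ h g, emb (T h g) = translateDual W c h (emb g)) ∧ ∀ g, Continuous fun h => T h g

/-- `incl` is the inclusion `S^*_†(ℝ^d) ⊆ F`, i.e. its composition with `emb` sends a test
function `φ` to the ultradistribution `ψ ↦ ∫ φ ψ`. -/
def IsInclusion (incl : TestSpace W c d →L[ℂ] F) (emb : F →L[ℂ] Ultradistribution W c d) : Prop :=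
  ∀ φ ψ : TestSpace W c d, emb (incl φ) ψ = ∫ x, φ x * ψ x

/-- `a')`: there are continuous inclusions `S^*_†(ℝ^d) → F ↪ S'^*_†(ℝ^d)`, the second one with
dense range. -/
def AxiomA' (emb : F →L[ℂ] Ultradistribution W c d) : Prop :=
  (∃ incl : TestSpace W c d →L[ℂ] F, IsInclusion incl emb ∧ Function.Injective incl) ∧
    Function.Injective emb ∧ DenseRange emb

end Axioms

/-- A translation-invariant Banach space of ultradistributions of class `*-†`: a space `E` (which
is assumed to be complete where this is used) with continuous and dense inclusions
`S^*_†(ℝ^d) ↪ E ↪ S'^*_†(ℝ^d)` that satisfies `(II)` and `(III)`. -/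
structure TISpace (W : WeightPair) (c : UltraCase) (d : ℕ)
    (E : Type*) [NormedAddCommGroup E] [NormedSpace ℂ E] where
  incl : TestSpace W c d →L[ℂ] E
  emb : E →L[ℂ] Ultradistribution W c d
  emb_injective : Function.Injective emb
  isInclusion : IsInclusion incl emb
  denseRange_incl : DenseRange incl
  denseRange_emb : DenseRange emb
  axiomII : AxiomII emb
  axiomIII : AxiomIII emb

namespace TISpace

variable {W : WeightPair} {c : UltraCase} {d : ℕ}
  {E : Type*} [NormedAddCommGroup E] [NormedSpace ℂ E] (X : TISpace W c d E)

lemma exists_bound : ∃ τ : ℝ, 0 < τ ∧ ∃ C : ℝ, 0 < C ∧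
    ∀ (h : Rd d) (g g' : E), X.emb g' = translateDual W c h (X.emb g) →
      ‖g'‖ ≤ C * ‖g‖ * Real.exp (W.assoc (τ * ‖h‖)) := by
  have := X.axiomIII
  cases c with
  | beurling => exact this
  | roumieu => exact ⟨1, one_pos, this 1 one_pos⟩

/-- The translation operator `T_h` on `E`, as a map: `T_h g` is the element of `E` whose
ultradistribution is the translate of that of `g`. -/
def translFun (h : Rd d) (g : E) : E := (X.axiomII h g).choose

lemma emb_translFun (h : Rd d) (g : E) :
    X.emb (X.translFun h g) = translateDual W c h (X.emb g) :=
  (X.axiomII h g).choose_spec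

/-- The translation operator `T_h` on `E`, as a linear map. -/
def translₗ (h : Rd d) : E →ₗ[ℂ] E where
  toFun := X.translFun h
  map_add' g₁ g₂ := X.emb_injective <| by
    simp only [map_add, emb_translFun]
  map_smul' a g := X.emb_injective <| by
    simp only [map_smul, emb_translFun, RingHom.id_apply]

/-- The translation operator `T_h` on `E`. -/
def transl (h : Rd d) : E →L[ℂ] E :=
  (X.translₗ h).mkContinuousOfExistsBound <| by
    obtain ⟨τ, _, C, _, hC⟩ := X.exists_bound
    refine ⟨C * Real.exp (W.assoc (τ * ‖h‖)), fun g => ?_⟩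
    refine (hC h g _ (X.axiomII h g).choose_spec).trans (le_of_eq (by ring))

lemma emb_transl (h : Rd d) (g : E) : X.emb (X.transl h g) = translateDual W c h (X.emb g) :=
  (X.axiomII h g).choose_spec

lemma transl_add (h k : Rd d) (g : E) : X.transl (h + k) g = X.transl h (X.transl k g) := by
  refine X.emb_injective ?_
  rw [emb_transl, emb_transl, emb_transl]
  ext φ
  have : TestSpace.translate W c (-(h + k)) φ =
      TestSpace.translate W c (-k) (TestSpace.translate W c (-h) φ) := by
    refine Subtype.ext (funext fun x => ?_)
    change φ (x + -(h + k)) = φ (x + -k + -h)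
    rw [neg_add_rev, add_assoc]
  exact congrArg (X.emb g) this

lemma transl_incl (h : Rd d) (φ : TestSpace W c d) :
    X.transl h (X.incl φ) = X.incl (TestSpace.translate W c h φ) := by
  refine X.emb_injective ?_
  rw [emb_transl]
  ext ψ
  change X.emb (X.incl φ) (TestSpace.translate W c (-h) ψ) = _
  rw [X.isInclusion, X.isInclusion]
  rw [← integral_add_right_eq_self _ h]
  simp

lemma tendsto_transl_zero (g : E) : Tendsto (fun h => X.transl h g) (𝓝 0) (𝓝 g) := by
  obtain ⟨τ, hτ, C, hC0, hC⟩ := X.exists_bound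
  set B : ℝ := C * Real.exp (W.assoc τ) with hB
  have hB0 : 0 < B := by positivity
  have hb : ∀ h : Rd d, ‖h‖ ≤ 1 → ∀ g, ‖X.transl h g‖ ≤ B * ‖g‖ := by
    intro h hh g
    refine (hC h g _ (X.emb_transl h g)).trans ?_
    have : Real.exp (W.assoc (τ * ‖h‖)) ≤ Real.exp (W.assoc τ) :=
      Real.exp_le_exp.2 (W.assoc_mono (by positivity) (mul_le_of_le_one_right hτ.le hh))
    calc _ ≤ C * ‖g‖ * Real.exp (W.assoc τ) := by gcongr
      _ = _ := by rw [hB]; ring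
  rw [Metric.tendsto_nhds]
  intro ε hε
  obtain ⟨φ, hφ⟩ := X.denseRange_incl.exists_dist_lt g (show 0 < ε / (2 * (B + 1)) by positivity)
  have h1 : Tendsto (fun h => X.transl h (X.incl φ)) (𝓝 0) (𝓝 (X.incl φ)) := by
    simp_rw [X.transl_incl]
    exact (X.incl.continuous.tendsto φ).comp (TestSpace.tendsto_translate φ)
  filter_upwards [Metric.tendsto_nhds.1 h1 (ε / 2) (by positivity),
    Metric.closedBall_mem_nhds (0 : Rd d) one_pos] with h h2 h3
  rw [dist_eq_norm] at *
  have e : X.transl h g - g =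
      X.transl h (g - X.incl φ) + (X.transl h (X.incl φ) - X.incl φ) - (g - X.incl φ) := by
    rw [map_sub]
    abel
  have h4 := hb h (by simpa using h3) (g - X.incl φ)
  rw [e]
  have h5 : (B + 1) * ‖g - X.incl φ‖ < ε / 2 := by
    have := mul_lt_mul_of_pos_left hφ (show 0 < B + 1 by positivity)
    refine this.trans_le (le_of_eq ?_)
    field_simp
  calc _ ≤ ‖X.transl h (g - X.incl φ)‖ + ‖X.transl h (X.incl φ) - X.incl φ‖ +
        ‖g - X.incl φ‖ := (norm_sub_le _ _).trans (by gcongr; exact norm_add_le _ _)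
    _ < ε := by linarith

/-- For every `g ∈ E` the map `h ↦ T_h g` is continuous. -/
lemma continuous_transl (g : E) : Continuous fun h => X.transl h g := by
  refine continuous_iff_continuousAt.2 fun k => ?_
  have h1 : Tendsto (fun h : Rd d => h - k) (𝓝 k) (𝓝 0) := by
    have : Continuous fun h : Rd d => h - k := by fun_prop
    simpa using this.tendsto k
  have h2 := (X.tendsto_transl_zero (X.transl k g)).comp h1
  refine h2.congr fun h => ?_
  simp [← X.transl_add]

/-- The weight function `ω(h) = ‖T_{-h}‖` of `E`. -/
def weight (h : Rd d) : ℝ := ‖X.transl (-h)‖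

/-- The translation `T_h` on the dual space `E'`, `⟨T_h f, g⟩ = ⟨f, T_{-h} g⟩`. -/
def dualTransl (h : Rd d) : StrongDual ℂ E →L[ℂ] StrongDual ℂ E :=
  ContinuousLinearMap.precomp ℂ (X.transl (-h))

/-- The weight function `ω̌(h) = ‖T_{-h}‖` of `E'`. -/
def dualWeight (h : Rd d) : ℝ := ‖X.dualTransl (-h)‖

lemma dualWeight_eq (h : Rd d) : X.dualWeight h = X.weight (-h) := by
  unfold dualWeight weight dualTransl
  rw [neg_neg]
  refine le_antisymm ?_ ?_
  · refine ContinuousLinearMap.opNorm_le_bound _ (by positivity) fun f => ?_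
    rw [mul_comm]
    exact ContinuousLinearMap.opNorm_comp_le f (X.transl h)
  · refine ContinuousLinearMap.opNorm_le_bound _ (by positivity) fun g => ?_
    refine NormedSpace.norm_le_dual_bound ℂ _ (by positivity) fun f => ?_
    change ‖ContinuousLinearMap.precomp ℂ (X.transl h) f g‖ ≤ _
    refine (ContinuousLinearMap.le_opNorm _ g).trans ?_
    rw [mul_right_comm]
    gcongr
    exact ContinuousLinearMap.le_opNorm _ f

end TISpace

/-! ### Beurling algebras and convolution -/

/-- The space `L^1_η` of (representatives of) measurable functions `u` with `∫ |u| η < ∞`. -/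
def beurlingL1 {d : ℕ} (η : Rd d → ℝ) : Submodule ℂ (Rd d → ℂ) where
  carrier := {u | AEStronglyMeasurable u volume ∧ Integrable (fun x => η x • u x) volume}
  zero_mem' := ⟨aestronglyMeasurable_const, by simp⟩
  add_mem' := by
    rintro u v ⟨hu, hu'⟩ ⟨hv, hv'⟩
    refine ⟨hu.add hv, ?_⟩
    exact (hu'.add hv').congr (Eventually.of_forall fun x => (smul_add _ _ _).symm)
  smul_mem' := by
    rintro a u ⟨hu, hu'⟩
    refine ⟨hu.const_smul a, ?_⟩
    have := hu'.smul a
    refine this.congr (Eventually.of_forall fun x => ?_)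
    simp only [Pi.smul_apply]
    exact smul_comm _ _ _

/-- The norm `‖u‖_{1,η} = ∫ |u| η` of `L^1_η`. -/
def beurlingNorm {d : ℕ} (η : Rd d → ℝ) (u : Rd d → ℂ) : ℝ := ∫ x, ‖u x‖ * η x

/-- The mollifiers `φ_ε(x) = ε^{-d} φ(x / ε)`. -/
def mollifier {d : ℕ} (φ : Rd d → ℂ) (ε : ℝ) (x : Rd d) : ℂ :=
  ((ε ^ d)⁻¹ : ℝ) • φ (ε⁻¹ • x)

namespace TISpace

variable {W : WeightPair} {c : UltraCase} {d : ℕ}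
  {E : Type*} [NormedAddCommGroup E] [NormedSpace ℂ E] (X : TISpace W c d E)

lemma norm_smul_transl_le (u : Rd d → ℂ) (g : E) (y : Rd d) :
    ‖u y • X.transl (-y) g‖ ≤ ‖u y‖ * X.weight y * ‖g‖ := by
  rw [norm_smul, mul_assoc]
  gcongr
  exact ContinuousLinearMap.le_opNorm _ _

lemma integrable_norm_mul_weight {u : Rd d → ℂ} (hu : u ∈ beurlingL1 X.weight) :
    Integrable fun y => ‖u y‖ * X.weight y := by
  refine hu.2.norm.congr (Eventually.of_forall fun y => ?_)
  simp only [norm_smul]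
  rw [Real.norm_of_nonneg (show 0 ≤ X.weight y from norm_nonneg _), mul_comm]

lemma integrable_smul_transl {u : Rd d → ℂ} (hu : u ∈ beurlingL1 X.weight) (g : E) :
    Integrable fun y => u y • X.transl (-y) g := by
  refine ((X.integrable_norm_mul_weight hu).mul_const ‖g‖).mono'
    (hu.1.smul ?_) (Eventually.of_forall fun y => X.norm_smul_transl_le u g y)
  exact ((X.continuous_transl g).comp continuous_neg).stronglyMeasurable.aestronglyMeasurable

/-- The convolution `u * g = ∫ u(y) T_{-y} g dy ∈ E` of `u ∈ L^1_ω` and `g ∈ E`, as a continuous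
linear operator in `g`. -/
def conv (u : beurlingL1 X.weight) : E →L[ℂ] E :=
  LinearMap.mkContinuous
    { toFun := fun g => ∫ y, u.1 y • X.transl (-y) g
      map_add' := fun g₁ g₂ => by
        rw [← integral_add (X.integrable_smul_transl u.2 g₁) (X.integrable_smul_transl u.2 g₂)]
        simp
      map_smul' := fun a g => by
        rw [RingHom.id_apply, ← integral_smul]
        refine integral_congr_ae (Eventually.of_forall fun y => ?_)
        simp only [map_smul]
        exact smul_comm _ _ _ }
    (beurlingNorm X.weight u)
    fun g => by
      unfold beurlingNorm
      rw [← integral_mul_const]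
      exact norm_integral_le_of_norm_le ((X.integrable_norm_mul_weight u.2).mul_const ‖g‖)
        (Eventually.of_forall fun y => X.norm_smul_transl_le u.1 g y)

/-- The reflection `ǔ(x) = u(-x)`, from `L^1_ω̌` to `L^1_ω`. -/
def reflect (u : beurlingL1 X.dualWeight) : beurlingL1 X.weight :=
  ⟨fun x => u.1 (-x), by
    refine ⟨u.2.1.comp_measurePreserving (Measure.measurePreserving_neg volume), ?_⟩
    have := u.2.2.comp_neg
    simpa [X.dualWeight_eq] using this⟩

/-- The convolution `u * f ∈ E'` of `u ∈ L^1_ω̌` and `f ∈ E'`, `⟨u * f, g⟩ = ⟨f, ǔ * g⟩`. -/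
def dualConv (u : beurlingL1 X.dualWeight) (f : StrongDual ℂ E) : StrongDual ℂ E :=
  f.comp (X.conv (X.reflect u))

/-- The set `E'_* = L^1_ω̌ * E'` of all convolutions `u * f`, `u ∈ L^1_ω̌`, `f ∈ E'`. -/
def goodDual : Set (StrongDual ℂ E) :=
  {k | ∃ (u : beurlingL1 X.dualWeight) (f : StrongDual ℂ E), k = X.dualConv u f}

/-- The embedding `E' → S'^*_†(ℝ^d)`, which restricts a functional to `S^*_†(ℝ^d) ⊆ E`. -/
def dualEmb : StrongDual ℂ E →L[ℂ] Ultradistribution W c d :=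
  ContinuousLinearMap.precomp ℂ X.incl

/-- The restriction of the embedding `E' → S'^*_†(ℝ^d)` to a linear subspace `V` of `E'`. -/
def subEmb (V : Submodule ℂ (StrongDual ℂ E)) : V →L[ℂ] Ultradistribution W c d :=
  X.dualEmb.comp V.subtypeL

/-- The translations of `E'` are those of `S'^*_†(ℝ^d)`. -/
lemma dualEmb_dualTransl (h : Rd d) (f : StrongDual ℂ E) :
    X.dualEmb (X.dualTransl h f) = translateDual W c h (X.dualEmb f) := by
  ext φ
  change f (X.transl (-h) (X.incl φ)) = f (X.incl (TestSpace.translate W c (-h) φ))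
  rw [X.transl_incl]

/-- A (closed) linear subspace `V` of `E'` is a Banach module over the Beurling algebra `L^1_ω̌`
under convolution: the action `(u, f) ↦ u * f` maps `L^1_ω̌ × V` to `V`, is bilinear,
associative with respect to the convolution product of `L^1_ω̌`, and satisfies
`‖u * f‖ ≤ ‖u‖_{1,ω̌} ‖f‖`. -/
structure IsBanachModule (V : Submodule ℂ (StrongDual ℂ E)) : Prop where
  mem : ∀ u, ∀ f ∈ V, X.dualConv u f ∈ V
  add_left : ∀ u v, ∀ f ∈ V, X.dualConv (u + v) f = X.dualConv u f + X.dualConv v f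
  smul_left : ∀ (a : ℂ) (u), ∀ f ∈ V, X.dualConv (a • u) f = a • X.dualConv u f
  add_right : ∀ u, ∀ f ∈ V, ∀ g ∈ V, X.dualConv u (f + g) = X.dualConv u f + X.dualConv u g
  smul_right : ∀ (a : ℂ) (u), ∀ f ∈ V, X.dualConv u (a • f) = a • X.dualConv u f
  assoc : ∀ u v : beurlingL1 X.dualWeight,
    ∃ w : beurlingL1 X.dualWeight,
      (w : Rd d → ℂ) =ᵐ[volume] (fun x => ∫ y, u.1 y * v.1 (x - y)) ∧
      ∀ f ∈ V, X.dualConv w f = X.dualConv u (X.dualConv v f)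
  norm_le : ∀ u, ∀ f ∈ V, ‖X.dualConv u f‖ ≤ beurlingNorm X.dualWeight u * ‖f‖

end TISpace

end UltraTI
end

noncomputable section
open MeasureTheory Filter Topology
open scoped ContDiff
namespace UltraTI

/-! ### Cohen factorization -/

section Cohen

variable {Y : Type*} [NormedAddCommGroup Y] [NormedSpace ℂ Y]

lemma tendsto_clm_apply {T : ℕ → Y →L[ℂ] Y} {T₀ : Y →L[ℂ] Y} {y : ℕ → Y} {y₀ : Y}
    (hT : Tendsto T atTop (𝓝 T₀)) (hy : Tendsto y atTop (𝓝 y₀)) :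
    Tendsto (fun n => T n (y n)) atTop (𝓝 (T₀ y₀)) :=
  (isBoundedBilinearMap_apply.continuous.tendsto (T₀, y₀)).comp (hT.prodMk_nhds hy)

lemma tendsto_mul_sub_one_mul {e : ℕ → Y →L[ℂ] Y} {K : Y →L[ℂ] Y}
    (hK : Tendsto (fun n => e n * K) atTop (𝓝 K)) :
    Tendsto (fun n => (e n - 1) * K) atTop (𝓝 0) := by
  have := hK.sub_const K
  simpa [sub_mul] using this

variable [CompleteSpace Y]

/-- The induction step of the Cohen factorization theorem. -/
lemma exists_unit_near {e : ℕ → Y →L[ℂ] Y} {C : ℝ} (hC : ∀ n, ‖e n‖ ≤ C) {f : Y}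
    (hf : Tendsto (fun n => e n f) atTop (𝓝 f))
    (he : ∀ k, Tendsto (fun n => e n * e k) atTop (𝓝 (e k)))
    {l : ℝ} (hl : 0 < l) (hlC : l * (1 + C) ≤ 1 / 2) {s : ℝ} (S : (Y →L[ℂ] Y)ˣ)
    (hS : Tendsto (fun n => e n * (S - (s : ℂ) • 1)) atTop (𝓝 (S - (s : ℂ) • 1)))
    {ε : ℝ} (hε : 0 < ε) :
    ∃ (n : ℕ) (S' : (Y →L[ℂ] Y)ˣ), (S' : Y →L[ℂ] Y) = S + ((s * l : ℝ) : ℂ) • (e n - 1) ∧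
      ‖(↑S'⁻¹ : Y →L[ℂ] Y) f - (↑S⁻¹ : Y →L[ℂ] Y) f‖ < ε ∧
      Tendsto (fun m => e m * (S' - ((s * (1 - l) : ℝ) : ℂ) • 1)) atTop
        (𝓝 (S' - ((s * (1 - l) : ℝ) : ℂ) • 1)) := by
  set K : Y →L[ℂ] Y := S - (s : ℂ) • 1 with hKdef
  have hSK : (S : Y →L[ℂ] Y) = (s : ℂ) • 1 + K := by rw [hKdef]; abel
  set δ : ℕ → Y →L[ℂ] Y := fun n => (l : ℂ) • ((e n - 1) * K) with hδ
  have hδ0 : Tendsto δ atTop (𝓝 0) := by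
    simpa only [smul_zero] using (tendsto_mul_sub_one_mul hS).const_smul (l : ℂ)
  have ht : ∀ n, ‖(l : ℂ) • (1 - e n)‖ ≤ 1 / 2 := by
    intro n
    have h1 : ‖(1 : Y →L[ℂ] Y)‖ ≤ 1 := ContinuousLinearMap.norm_id_le
    rw [norm_smul, Complex.norm_real, Real.norm_of_nonneg hl.le]
    refine le_trans ?_ hlC
    gcongr
    exact (norm_sub_le _ _).trans (add_le_add h1 (hC n))
  have ht1 : ∀ n, ‖(l : ℂ) • (1 - e n)‖ < 1 := fun n => (ht n).trans_lt (by norm_num)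
  set c : ℕ → (Y →L[ℂ] Y)ˣ := fun n => Units.oneSub _ (ht1 n) with hc
  have hcv : ∀ n, (c n : Y →L[ℂ] Y) = 1 - (l : ℂ) • (1 - e n) := fun n => rfl
  have hclow : ∀ n x, ‖x‖ ≤ 2 * ‖(c n : Y →L[ℂ] Y) x‖ := by
    intro n x
    have h1 : ‖((l : ℂ) • (1 - e n)) x‖ ≤ 1 / 2 * ‖x‖ :=
      (ContinuousLinearMap.le_opNorm _ _).trans (by gcongr; exact ht n)
    have h2 : x = (c n : Y →L[ℂ] Y) x + ((l : ℂ) • (1 - e n)) x := by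
      rw [hcv]; simp
    have h3 := norm_add_le ((c n : Y →L[ℂ] Y) x) (((l : ℂ) • (1 - e n)) x)
    rw [← h2] at h3
    linarith
  have hcS : ∀ n, (c n : Y →L[ℂ] Y) * S = S + ((s * l : ℝ) : ℂ) • (e n - 1) + δ n := by
    intro n
    rw [hcv, hδ]
    dsimp only
    conv_lhs => rw [hSK]
    conv_rhs => rw [hSK]
    simp only [Complex.ofReal_mul, sub_mul, smul_sub, mul_add, mul_smul_comm, smul_mul_assoc,
      one_mul, mul_one, mul_smul]
    rw [smul_comm (s : ℂ) (l : ℂ) (e n), smul_comm (s : ℂ) (l : ℂ) (1 : Y →L[ℂ] Y)]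
    abel
  have hcd : ∀ n, ‖(↑(c n)⁻¹ : Y →L[ℂ] Y) * δ n‖ ≤ 2 * ‖δ n‖ := by
    intro n
    refine ContinuousLinearMap.opNorm_le_bound _ (by positivity) fun x => ?_
    refine (hclow n _).trans ?_
    rw [← mul_apply_eq_comp, ← mul_assoc, Units.mul_inv, one_mul, mul_assoc]
    gcongr
    exact ContinuousLinearMap.le_opNorm _ _
  have hcd0 : Tendsto (fun n => (S : Y →L[ℂ] Y) - (↑(c n)⁻¹ : Y →L[ℂ] Y) * δ n) atTop
      (𝓝 (S : Y →L[ℂ] Y)) := by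
    have : Tendsto (fun n => (↑(c n)⁻¹ : Y →L[ℂ] Y) * δ n) atTop (𝓝 0) := by
      refine squeeze_zero_norm hcd ?_
      simpa using hδ0.norm.const_mul 2
    simpa using this.const_sub (S : Y →L[ℂ] Y)
  have hunit := hcd0.eventually (Units.isOpen.mem_nhds S.isUnit)
  set B : ℝ := ‖(↑S⁻¹ : Y →L[ℂ] Y)‖ with hB
  have hsmall : ∀ᶠ n in atTop, 2 * B * ‖δ n‖ < 1 / 2 := by
    have : Tendsto (fun n => 2 * B * ‖δ n‖) atTop (𝓝 0) := by
      simpa using hδ0.norm.const_mul (2 * B)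
    exact this.eventually (gt_mem_nhds (by norm_num))
  set g : Y := (↑S⁻¹ : Y →L[ℂ] Y) f with hg
  have hSg : (S : Y →L[ℂ] Y) g = f := by
    rw [hg, ← mul_apply_eq_comp, Units.mul_inv]; rfl
  have hlim : Tendsto (fun n => 4 * B * ‖(l : ℂ) • (e n f - f) - δ n g‖) atTop (𝓝 0) := by
    have h1 : Tendsto (fun n => (l : ℂ) • (e n f - f) - δ n g) atTop (𝓝 0) := by
      have h2 := (hf.sub_const f).const_smul (l : ℂ)
      have h3 : Tendsto (fun n => δ n g) atTop (𝓝 0) := by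
        simpa using tendsto_clm_apply hδ0 (tendsto_const_nhds (x := g))
      simpa using h2.sub h3
    simpa using h1.norm.const_mul (4 * B)
  obtain ⟨n, hn1, hn2, hn3⟩ :=
    (hunit.and (hsmall.and (hlim.eventually (gt_mem_nhds hε)))).exists
  obtain ⟨R, hR⟩ := hn1
  have hval : ((c n * R : (Y →L[ℂ] Y)ˣ) : Y →L[ℂ] Y) = S + ((s * l : ℝ) : ℂ) • (e n - 1) := by
    rw [Units.val_mul, hR, mul_sub, ← mul_assoc, Units.mul_inv, one_mul, hcS]
    abel
  refine ⟨n, c n * R, hval, ?_, ?_⟩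
  · set S' := c n * R
    have hlow : ∀ x, ‖x‖ ≤ 4 * B * ‖(S' : Y →L[ℂ] Y) x‖ := by
      intro x
      have h1 : ‖x‖ ≤ B * ‖(S : Y →L[ℂ] Y) x‖ := by
        have := ContinuousLinearMap.le_opNorm (↑S⁻¹ : Y →L[ℂ] Y) ((S : Y →L[ℂ] Y) x)
        rwa [← mul_apply_eq_comp, Units.inv_mul] at this
      have h2 := hclow n ((S : Y →L[ℂ] Y) x)
      rw [← mul_apply_eq_comp, hcS, ← hval] at h2
      have h3 : ‖((S' : Y →L[ℂ] Y) + δ n) x‖ ≤ ‖(S' : Y →L[ℂ] Y) x‖ + ‖δ n‖ * ‖x‖ :=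
        (norm_add_le _ _).trans (add_le_add le_rfl (ContinuousLinearMap.le_opNorm _ _))
      have hB0 : 0 ≤ B := norm_nonneg _
      have h4 : ‖x‖ ≤ B * (2 * (‖(S' : Y →L[ℂ] Y) x‖ + ‖δ n‖ * ‖x‖)) :=
        h1.trans (by gcongr; exact h2.trans (by gcongr))
      have h5 : 2 * B * ‖δ n‖ * ‖x‖ ≤ 1 / 2 * ‖x‖ := by gcongr
      linarith
    refine (hlow _).trans_lt (lt_of_eq_of_lt ?_ hn3)
    congr 1
    have e1 : (S' : Y →L[ℂ] Y) ((↑S'⁻¹ : Y →L[ℂ] Y) f) = f := by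
      rw [← mul_apply_eq_comp, Units.mul_inv]; rfl
    have e2 : (S' : Y →L[ℂ] Y) g = f + ((l : ℂ) • (e n f - f) - δ n g) := by
      have : (S' : Y →L[ℂ] Y) = c n * S - δ n := by rw [hcS, hval]; abel
      rw [this, sub_apply, mul_apply_eq_comp, hSg, hcv]
      simp only [sub_apply, smul_apply,
        one_apply_eq_self, smul_sub]
      abel
    rw [map_sub, e1, e2, ← norm_neg]
    congr 1
    abel
  · have e1 : ((c n * R : (Y →L[ℂ] Y)ˣ) : Y →L[ℂ] Y) - ((s * (1 - l) : ℝ) : ℂ) • 1 =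
        K + ((s * l : ℝ) : ℂ) • e n := by
      rw [hval, hKdef]
      simp only [mul_sub, mul_one, Complex.ofReal_sub, sub_smul, smul_sub]
      abel
    rw [e1]
    simp only [mul_add, mul_smul_comm]
    exact hS.add ((he n).const_smul _)

/-- The Cohen factorization theorem, for a sequence of operators that is a bounded approximate
identity. -/
theorem cohen_factorization {e : ℕ → Y →L[ℂ] Y} {C : ℝ} (hC : ∀ n, ‖e n‖ ≤ C) {f : Y}
    (hf : Tendsto (fun n => e n f) atTop (𝓝 f))
    (he : ∀ k, Tendsto (fun n => e n * e k) atTop (𝓝 (e k))) :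
    ∃ (a : ℕ → ℝ) (φ : ℕ → ℕ) (g : Y), (∀ k, 0 ≤ a k) ∧ Summable a ∧
      HasSum (fun k => (a k : ℂ) • e (φ k) g) f := by
  have hC0 : 0 ≤ C := (norm_nonneg _).trans (hC 0)
  set l : ℝ := 1 / (2 * (1 + C)) with hldef
  have hl : 0 < l := by positivity
  have hlC : l * (1 + C) ≤ 1 / 2 := by rw [hldef]; field_simp; rfl
  have hl1 : l < 1 := by nlinarith
  have step : ∀ (k : ℕ) (S : {S : (Y →L[ℂ] Y)ˣ //
      Tendsto (fun n => e n * (S - (((1 - l) ^ k : ℝ) : ℂ) • 1)) atTop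
        (𝓝 (S - (((1 - l) ^ k : ℝ) : ℂ) • 1))}),
      ∃ S' : {S : (Y →L[ℂ] Y)ˣ //
      Tendsto (fun n => e n * (S - (((1 - l) ^ (k + 1) : ℝ) : ℂ) • 1)) atTop
        (𝓝 (S - (((1 - l) ^ (k + 1) : ℝ) : ℂ) • 1))}, ∃ n : ℕ,
        (S'.1 : Y →L[ℂ] Y) = S.1 + (((1 - l) ^ k * l : ℝ) : ℂ) • (e n - 1) ∧
        ‖(↑S'.1⁻¹ : Y →L[ℂ] Y) f - (↑S.1⁻¹ : Y →L[ℂ] Y) f‖ < 1 / 2 / 2 ^ k := by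
    rintro k ⟨S, hS⟩
    obtain ⟨n, S', h1, h2, h3⟩ := exists_unit_near hC hf he hl hlC S hS
      (show (0 : ℝ) < 1 / 2 / 2 ^ k by positivity)
    rw [← pow_succ] at h3
    exact ⟨⟨S', h3⟩, n, h1, h2⟩
  choose F φ' hF1 hF2 using step
  let S : (k : ℕ) → {S : (Y →L[ℂ] Y)ˣ //
      Tendsto (fun n => e n * (S - (((1 - l) ^ k : ℝ) : ℂ) • 1)) atTop
        (𝓝 (S - (((1 - l) ^ k : ℝ) : ℂ) • 1))} := fun k =>
    Nat.rec ⟨1, by simp⟩ (fun k S => F k S) k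
  set φ : ℕ → ℕ := fun k => φ' k (S k)
  set a : ℕ → ℝ := fun k => (1 - l) ^ k * l with ha
  set g : ℕ → Y := fun k => (↑(S k).1⁻¹ : Y →L[ℂ] Y) f with hg
  have hrec : ∀ k, ((S (k + 1)).1 : Y →L[ℂ] Y) = (S k).1 + (a k : ℂ) • (e (φ k) - 1) :=
    fun k => hF1 k (S k)
  have hclosed : ∀ k, ((S k).1 : Y →L[ℂ] Y) =
      (((1 - l) ^ k : ℝ) : ℂ) • 1 + ∑ i ∈ Finset.range k, (a i : ℂ) • e (φ i) := by
    intro k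
    induction k with
    | zero => simp [S]
    | succ k ih =>
      rw [hrec, ih, Finset.sum_range_succ, ha]
      simp only [pow_succ, mul_sub, mul_one, Complex.ofReal_sub, sub_smul, smul_sub]
      abel
  have ha0 : ∀ k, 0 ≤ a k := fun k => mul_nonneg (pow_nonneg (by linarith) _) hl.le
  have hasum : Summable a :=
    (summable_geometric_of_lt_one (by linarith) (by linarith)).mul_right l
  have hopsum : Summable fun k => (a k : ℂ) • e (φ k) := by
    refine Summable.of_norm_bounded (hasum.mul_right C) fun k => ?_
    rw [norm_smul, Complex.norm_real, Real.norm_of_nonneg (ha0 k)]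
    exact mul_le_mul_of_nonneg_left (hC _) (ha0 k)
  have hSlim : Tendsto (fun k => ((S k).1 : Y →L[ℂ] Y)) atTop
      (𝓝 (∑' k, (a k : ℂ) • e (φ k))) := by
    simp_rw [hclosed]
    have h1 : Tendsto (fun k : ℕ => (((1 - l) ^ k : ℝ) : ℂ) • (1 : Y →L[ℂ] Y)) atTop (𝓝 0) := by
      have h2 : Tendsto (fun k : ℕ => (1 - l) ^ k) atTop (𝓝 0) :=
        tendsto_pow_atTop_nhds_zero_of_lt_one (by linarith) (by linarith)
      have h3 : Tendsto (fun k : ℕ => (((1 - l) ^ k : ℝ) : ℂ)) atTop (𝓝 0) := by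
        exact_mod_cast (Complex.continuous_ofReal.tendsto 0).comp h2
      simpa using h3.smul_const (1 : Y →L[ℂ] Y)
    simpa using h1.add hopsum.hasSum.tendsto_sum_nat
  have hgc : CauchySeq g := by
    refine cauchySeq_of_le_geometric_two (C := 1) fun k => ?_
    rw [dist_comm, dist_eq_norm]
    exact (hF2 k (S k)).le
  obtain ⟨g₀, hg₀⟩ := cauchySeq_tendsto_of_complete hgc
  refine ⟨a, φ, g₀, ha0, hasum, ?_⟩
  have h1 := tendsto_clm_apply hSlim hg₀
  have h2 : ∀ k, ((S k).1 : Y →L[ℂ] Y) (g k) = f := by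
    intro k
    rw [hg]
    dsimp only
    rw [← mul_apply_eq_comp, Units.mul_inv]; rfl
  simp_rw [h2] at h1
  have h3 := hopsum.hasSum.mapL (ContinuousLinearMap.apply ℂ Y g₀)
  have h4 := tendsto_nhds_unique tendsto_const_nhds h1
  rw [h4]
  exact h3

end Cohen

namespace TISpace

variable {W : WeightPair} {c : UltraCase} {d : ℕ}
  {E : Type*} [NormedAddCommGroup E] [NormedSpace ℂ E] (X : TISpace W c d E)

/-! ### The weight of the dual space -/

lemma dualWeight_eq_norm (h : Rd d) : X.dualWeight h = ‖X.transl h‖ := by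
  rw [dualWeight_eq, weight, neg_neg]

lemma dualWeight_nonneg (h : Rd d) : 0 ≤ X.dualWeight h := by
  rw [dualWeight_eq_norm]
  exact norm_nonneg _

lemma dualWeight_add_le (h k : Rd d) :
    X.dualWeight (h + k) ≤ X.dualWeight h * X.dualWeight k := by
  simp only [dualWeight_eq_norm]
  refine ContinuousLinearMap.opNorm_le_bound _ (by positivity) fun g => ?_
  rw [transl_add, mul_assoc]
  exact (ContinuousLinearMap.le_opNorm _ _).trans
    (mul_le_mul_of_nonneg_left (ContinuousLinearMap.le_opNorm _ _) (norm_nonneg _))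

lemma transl_zero (g : E) : X.transl 0 g = g := by
  have h1 := (X.continuous_transl g).tendsto 0
  exact tendsto_nhds_unique h1 (X.tendsto_transl_zero g)

lemma measurable_dualWeight : Measurable X.dualWeight := by
  refine LowerSemicontinuous.measurable fun h a ha => ?_
  change a < X.dualWeight h at ha
  change ∀ᶠ k in 𝓝 h, a < X.dualWeight k
  rw [dualWeight_eq_norm] at ha
  obtain ⟨g, hg, hag⟩ := ContinuousLinearMap.exists_lt_apply_of_lt_opNorm _ ha
  filter_upwards [(X.continuous_transl g).norm.tendsto h |>.eventually (lt_mem_nhds hag)] with k hk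
  rw [dualWeight_eq_norm]
  refine hk.trans_le ((ContinuousLinearMap.le_opNorm _ _).trans ?_)
  exact mul_le_of_le_one_right (norm_nonneg _) hg.le

lemma dualWeight_le_of_bound {τ C : ℝ} (hC : 0 ≤ C) (hb : TranslationBound X.emb τ C) (h : Rd d) :
    X.dualWeight h ≤ C * Real.exp (W.assoc (τ * ‖h‖)) := by
  rw [dualWeight_eq_norm]
  refine ContinuousLinearMap.opNorm_le_bound _ (by positivity) fun g => ?_
  exact (hb h g _ (X.emb_transl h g)).trans (le_of_eq (by ring))

lemma exists_dualWeight_le (R : ℝ) : ∃ B : ℝ, 0 < B ∧ ∀ h : Rd d, ‖h‖ ≤ R → X.dualWeight h ≤ B := by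
  obtain ⟨τ, hτ, C, hC, hb⟩ := X.exists_bound
  refine ⟨C * Real.exp (W.assoc (τ * R)), by positivity, fun h hh => ?_⟩
  refine (X.dualWeight_le_of_bound hC.le hb h).trans ?_
  gcongr
  exact W.assoc_mono (by positivity) (by gcongr)

/-! ### The module structure -/

lemma mem_beurlingL1_of_integrable {u : Rd d → ℂ} (hu : AEStronglyMeasurable u volume)
    (hi : Integrable fun x => ‖u x‖ * X.dualWeight x) : u ∈ beurlingL1 X.dualWeight := by
  refine ⟨hu, hi.mono (X.measurable_dualWeight.aestronglyMeasurable.smul hu)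
    (Eventually.of_forall fun x => ?_)⟩
  rw [norm_smul, norm_mul, norm_norm, mul_comm]

lemma mem_beurlingL1_of_support {u : Rd d → ℂ} (hu : Integrable u) {R : ℝ}
    (hR : ∀ x, R < ‖x‖ → u x = 0) : u ∈ beurlingL1 X.dualWeight := by
  obtain ⟨B, -, hB⟩ := X.exists_dualWeight_le R
  refine X.mem_beurlingL1_of_integrable hu.1 ((hu.norm.mul_const B).mono'
    (hu.1.norm.mul X.measurable_dualWeight.aestronglyMeasurable)
    (Eventually.of_forall fun x => ?_))
  rw [norm_mul, norm_norm, Real.norm_of_nonneg (X.dualWeight_nonneg x)]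
  by_cases hx : ‖x‖ ≤ R
  · gcongr
    exact hB x hx
  · simp [hR x (not_le.1 hx)]

lemma integrable_norm_mul_dualWeight {u : Rd d → ℂ} (hu : u ∈ beurlingL1 X.dualWeight) :
    Integrable fun y => ‖u y‖ * X.dualWeight y := by
  refine hu.2.norm.congr (Eventually.of_forall fun y => ?_)
  simp only [norm_smul]
  rw [Real.norm_of_nonneg (X.dualWeight_nonneg y), mul_comm]

lemma norm_apply_transl_le (f : StrongDual ℂ E) (g : E) (y : Rd d) :
    ‖f (X.transl y g)‖ ≤ X.dualWeight y * (‖f‖ * ‖g‖) := by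
  rw [dualWeight_eq_norm]
  calc _ ≤ ‖f‖ * (‖X.transl y‖ * ‖g‖) :=
        (f.le_opNorm _).trans (by gcongr; exact ContinuousLinearMap.le_opNorm _ _)
    _ = _ := by ring

lemma continuous_apply_transl (f : StrongDual ℂ E) (g : E) :
    Continuous fun y => f (X.transl y g) := f.continuous.comp (X.continuous_transl g)

lemma norm_mul_apply_transl_le (u : Rd d → ℂ) (f : StrongDual ℂ E) (g : E) (y : Rd d) :
    ‖u y * f (X.transl y g)‖ ≤ ‖u y‖ * X.dualWeight y * (‖f‖ * ‖g‖) := by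
  rw [norm_mul, mul_assoc]
  gcongr
  exact X.norm_apply_transl_le f g y

lemma integrable_mul_apply_transl {u : Rd d → ℂ} (hu : u ∈ beurlingL1 X.dualWeight)
    (f : StrongDual ℂ E) (g : E) : Integrable fun y => u y * f (X.transl y g) :=
  ((X.integrable_norm_mul_dualWeight hu).mul_const (‖f‖ * ‖g‖)).mono'
    (hu.1.mul (X.continuous_apply_transl f g).aestronglyMeasurable)
    (Eventually.of_forall fun y => X.norm_mul_apply_transl_le u f g y)

lemma dualConv_apply [CompleteSpace E] (u : beurlingL1 X.dualWeight) (f : StrongDual ℂ E) (g : E) :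
    X.dualConv u f g = ∫ y, u.1 y * f (X.transl y g) := by
  change f (∫ y, (X.reflect u).1 y • X.transl (-y) g) = _
  rw [← ContinuousLinearMap.integral_comp_comm f (X.integrable_smul_transl (X.reflect u).2 g),
    ← integral_neg_eq_self]
  refine integral_congr_ae (Eventually.of_forall fun y => ?_)
  simp [reflect]

lemma norm_dualConv_le [CompleteSpace E] (u : beurlingL1 X.dualWeight) (f : StrongDual ℂ E) :
    ‖X.dualConv u f‖ ≤ beurlingNorm X.dualWeight u * ‖f‖ := by
  have h0 : 0 ≤ beurlingNorm X.dualWeight u :=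
    integral_nonneg fun x => mul_nonneg (norm_nonneg _) (X.dualWeight_nonneg x)
  refine ContinuousLinearMap.opNorm_le_bound _ (by positivity) fun g => ?_
  rw [dualConv_apply, mul_assoc, beurlingNorm, ← integral_mul_const]
  exact norm_integral_le_of_norm_le
    ((X.integrable_norm_mul_dualWeight u.2).mul_const (‖f‖ * ‖g‖))
    (Eventually.of_forall fun y => X.norm_mul_apply_transl_le u.1 f g y)

/-- Convolution with `u ∈ L^1_ω̌` as an operator on `E'`. -/
def dualConvL (u : beurlingL1 X.dualWeight) : StrongDual ℂ E →L[ℂ] StrongDual ℂ E :=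
  ContinuousLinearMap.precomp ℂ (X.conv (X.reflect u))

lemma dualConvL_apply (u : beurlingL1 X.dualWeight) (f : StrongDual ℂ E) :
    X.dualConvL u f = X.dualConv u f := rfl

lemma dualConv_add_left [CompleteSpace E] (u v : beurlingL1 X.dualWeight) (f : StrongDual ℂ E) :
    X.dualConv (u + v) f = X.dualConv u f + X.dualConv v f := by
  ext g
  simp only [add_apply, dualConv_apply]
  rw [← integral_add (X.integrable_mul_apply_transl u.2 f g) (X.integrable_mul_apply_transl v.2 f g)]
  simp [add_mul]

lemma dualConv_smul_left [CompleteSpace E] (a : ℂ) (u : beurlingL1 X.dualWeight)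
    (f : StrongDual ℂ E) : X.dualConv (a • u) f = a • X.dualConv u f := by
  ext g
  simp only [smul_apply, dualConv_apply]
  rw [← integral_smul]
  simp [mul_assoc]

lemma integrable_conv_integrand {u v : Rd d → ℂ} (hu : u ∈ beurlingL1 X.dualWeight)
    (hv : v ∈ beurlingL1 X.dualWeight) :
    Integrable (fun p : Rd d × Rd d => ‖u p.2 * v (p.1 - p.2)‖ * X.dualWeight p.1)
      (volume.prod volume) := by
  have h1 := (X.integrable_norm_mul_dualWeight hu).convolution_integrand
    (ContinuousLinearMap.mul ℝ ℝ) (X.integrable_norm_mul_dualWeight hv)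
  have h2 := hu.1.convolution_integrand (ContinuousLinearMap.mul ℝ ℂ) hv.1
  refine h1.mono' (h2.norm.mul (X.measurable_dualWeight.comp measurable_fst).aestronglyMeasurable)
    (Eventually.of_forall fun p => ?_)
  have h3 := X.dualWeight_add_le p.2 (p.1 - p.2)
  rw [add_sub_cancel] at h3
  have := X.dualWeight_nonneg p.1
  simp only [norm_mul, norm_norm, ContinuousLinearMap.mul_apply', Real.norm_of_nonneg this]
  calc _ ≤ ‖u p.2‖ * ‖v (p.1 - p.2)‖ * (X.dualWeight p.2 * X.dualWeight (p.1 - p.2)) := by gcongr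
    _ = _ := by ring

lemma conv_mem_beurlingL1 {u v : Rd d → ℂ} (hu : u ∈ beurlingL1 X.dualWeight)
    (hv : v ∈ beurlingL1 X.dualWeight) :
    (fun x => ∫ y, u y * v (x - y)) ∈ beurlingL1 X.dualWeight := by
  have h1 := X.integrable_conv_integrand hu hv
  have h2 : AEStronglyMeasurable (fun x => ∫ y, u y * v (x - y)) volume :=
    (hu.1.convolution_integrand (ContinuousLinearMap.mul ℝ ℂ) hv.1).integral_prod_right'
  refine X.mem_beurlingL1_of_integrable h2 (h1.integral_prod_left.mono'
    (h2.norm.mul X.measurable_dualWeight.aestronglyMeasurable)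
    (Eventually.of_forall fun x => ?_))
  rw [norm_mul, norm_norm, Real.norm_of_nonneg (X.dualWeight_nonneg x)]
  dsimp only
  rw [integral_mul_const]
  gcongr
  · exact X.dualWeight_nonneg x
  · exact norm_integral_le_integral_norm _

lemma dualConv_assoc [CompleteSpace E] (u v : beurlingL1 X.dualWeight) (f : StrongDual ℂ E) :
    X.dualConv ⟨_, X.conv_mem_beurlingL1 u.2 v.2⟩ f = X.dualConv u (X.dualConv v f) := by
  ext g
  simp only [dualConv_apply]
  have hF : Integrable (fun p : Rd d × Rd d => u.1 p.2 * v.1 (p.1 - p.2) * f (X.transl p.1 g))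
      (volume.prod volume) := by
    refine ((X.integrable_conv_integrand u.2 v.2).mul_const (‖f‖ * ‖g‖)).mono'
      ((u.2.1.convolution_integrand (ContinuousLinearMap.mul ℝ ℂ) v.2.1).mul
        ((X.continuous_apply_transl f g).comp continuous_fst).aestronglyMeasurable)
      (Eventually.of_forall fun p => ?_)
    rw [norm_mul, mul_assoc]
    gcongr
    exact X.norm_apply_transl_le f g p.1
  calc _ = ∫ x, ∫ y, u.1 y * v.1 (x - y) * f (X.transl x g) := by
        simp only [integral_mul_const]
    _ = ∫ y, ∫ x, u.1 y * v.1 (x - y) * f (X.transl x g) := integral_integral_swap hF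
    _ = _ := by
        refine integral_congr_ae (Eventually.of_forall fun y => ?_)
        simp only [mul_assoc, integral_const_mul]
        congr 1
        rw [← integral_add_right_eq_self _ y]
        simp [transl_add]

/-! ### Translations of convolutions -/

lemma dualTransl_apply (h : Rd d) (f : StrongDual ℂ E) (g : E) :
    X.dualTransl h f g = f (X.transl (-h) g) := rfl

lemma dualTransl_add (h k : Rd d) (f : StrongDual ℂ E) :
    X.dualTransl (h + k) f = X.dualTransl h (X.dualTransl k f) := by
  ext g
  simp only [dualTransl_apply]
  rw [neg_add_rev, transl_add]

lemma dualTransl_comm (h k : Rd d) (f : StrongDual ℂ E) :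
    X.dualTransl h (X.dualTransl k f) = X.dualTransl k (X.dualTransl h f) := by
  rw [← dualTransl_add, add_comm, dualTransl_add]

lemma norm_dualTransl_le (h : Rd d) (f : StrongDual ℂ E) :
    ‖X.dualTransl h f‖ ≤ X.dualWeight (-h) * ‖f‖ := by
  rw [dualWeight, neg_neg]
  exact ContinuousLinearMap.le_opNorm _ _

lemma smul_sub_dualConv_apply [CompleteSpace E] (u : beurlingL1 X.dualWeight)
    (hu : Integrable u.1) (f : StrongDual ℂ E) (g : E) :
    ((∫ y, u.1 y) • f - X.dualConv u f) g = ∫ y, u.1 y * (f - X.dualTransl (-y) f) g := by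
  simp only [sub_apply, smul_apply, dualConv_apply, smul_eq_mul, dualTransl_apply, neg_neg,
    mul_sub]
  rw [integral_sub (hu.mul_const _) (X.integrable_mul_apply_transl u.2 f g), integral_mul_const]

/-- If `|u(y)| ‖f - T_{-y} f‖ ≤ G(y)`, then `‖(∫ u) f - u * f‖ ≤ ∫ G`. -/
lemma norm_smul_sub_dualConv_le [CompleteSpace E] (u : beurlingL1 X.dualWeight)
    (hu : Integrable u.1) (f : StrongDual ℂ E) {G : Rd d → ℝ} (hG : Integrable G)
    (hle : ∀ y, ‖u.1 y‖ * ‖f - X.dualTransl (-y) f‖ ≤ G y) :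
    ‖(∫ y, u.1 y) • f - X.dualConv u f‖ ≤ ∫ y, G y := by
  refine ContinuousLinearMap.opNorm_le_bound _
    (integral_nonneg fun y => le_trans (by positivity) (hle y)) fun g => ?_
  rw [smul_sub_dualConv_apply X u hu, ← integral_mul_const]
  refine norm_integral_le_of_norm_le (hG.mul_const ‖g‖) (Eventually.of_forall fun y => ?_)
  rw [norm_mul]
  calc _ ≤ ‖u.1 y‖ * (‖f - X.dualTransl (-y) f‖ * ‖g‖) := by
        gcongr
        exact ContinuousLinearMap.le_opNorm _ _
    _ ≤ _ := by
        rw [← mul_assoc]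
        gcongr
        exact hle y

end TISpace

lemma isClosed_setOf_tendsto_apply {ι Z : Type*} [NormedAddCommGroup Z] [NormedSpace ℂ Z]
    {l : Filter ι} {A : ι → Z →L[ℂ] Z} {B : ℝ} (hB : ∀ᶠ i in l, ‖A i‖ ≤ B) :
    IsClosed {z : Z | Tendsto (fun i => A i z) l (𝓝 z)} := by
  refine isClosed_of_closure_subset fun z hz => ?_
  change Tendsto (fun i => A i z) l (𝓝 z)
  rw [Metric.tendsto_nhds]
  intro ε hε
  have hδ : 0 < ε / (2 * (|B| + 1)) := by positivity
  obtain ⟨w, hw, hzw⟩ := Metric.mem_closure_iff.1 hz _ hδ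
  filter_upwards [hB, Metric.tendsto_nhds.1 hw (ε / 2) (by positivity)] with i h1 h2
  rw [dist_eq_norm] at *
  have e : A i z - z = A i (z - w) + (A i w - w) - (z - w) := by rw [map_sub]; abel
  have h3 : ‖A i (z - w)‖ ≤ |B| * ‖z - w‖ :=
    (ContinuousLinearMap.le_opNorm _ _).trans (by gcongr; exact h1.trans (le_abs_self B))
  have h4 : (|B| + 1) * ‖z - w‖ < ε / 2 := by
    have := mul_lt_mul_of_pos_left hzw (show 0 < |B| + 1 by positivity)
    refine this.trans_le (le_of_eq ?_)
    field_simp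
  rw [e]
  calc _ ≤ ‖A i (z - w)‖ + ‖A i w - w‖ + ‖z - w‖ :=
        (norm_sub_le _ _).trans (by gcongr; exact norm_add_le _ _)
    _ < ε := by linarith

lemma tendsto_clm_of_forall_norm_le {ι Z : Type*} [NormedAddCommGroup Z] [NormedSpace ℂ Z]
    {l : Filter ι} {T : ι → Z →L[ℂ] Z} {T₀ : Z →L[ℂ] Z}
    (h : ∀ ε : ℝ, 0 < ε → ∀ᶠ i in l, ∀ z, ‖T i z - T₀ z‖ ≤ ε * ‖z‖) : Tendsto T l (𝓝 T₀) := by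
  rw [Metric.tendsto_nhds]
  intro ε hε
  filter_upwards [h (ε / 2) (half_pos hε)] with i hi
  rw [dist_eq_norm]
  exact (ContinuousLinearMap.opNorm_le_bound _ (half_pos hε).le hi).trans_lt (half_lt_self hε)

lemma tendsto_clm_iff_norm_sub {ι Z : Type*} [NormedAddCommGroup Z] [NormedSpace ℂ Z]
    {l : Filter ι} {T : ι → Z →L[ℂ] Z} {T₀ : Z →L[ℂ] Z} :
    Tendsto T l (𝓝 T₀) ↔ Tendsto (fun i => ‖T i - T₀‖) l (𝓝 0) :=
  tendsto_iff_norm_sub_tendsto_zero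

lemma isClosed_setOf_tendsto_comp {ι Z : Type*} [NormedAddCommGroup Z] [NormedSpace ℂ Z]
    {l : Filter ι} {A : ι → Z →L[ℂ] Z} {B : ℝ} (hB : ∀ᶠ i in l, ‖A i‖ ≤ B) :
    IsClosed {R : Z →L[ℂ] Z | Tendsto (fun i => (A i).comp R) l (𝓝 R)} :=
  isClosed_setOf_tendsto_apply (A := fun i => ContinuousLinearMap.compL ℂ Z Z Z (A i))
    (hB.mono fun i hi => (ContinuousLinearMap.le_of_opNorm_le _
      (ContinuousLinearMap.norm_compL_le _ _ _ _) _).trans (by rwa [one_mul]))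

namespace TISpace

variable {W : WeightPair} {c : UltraCase} {d : ℕ}
  {E : Type*} [NormedAddCommGroup E] [NormedSpace ℂ E] (X : TISpace W c d E)

/-! ### Approximation by functions of compact support -/

lemma isLocallyFinite_withDensity_dualWeight :
    IsLocallyFiniteMeasure
      ((volume : Measure (Rd d)).withDensity fun x => ((X.dualWeight x).toNNReal : ENNReal)) := by
  refine ⟨fun x => ⟨Metric.ball x 1, Metric.ball_mem_nhds x one_pos, ?_⟩⟩
  rw [withDensity_apply _ measurableSet_ball]
  obtain ⟨B, hB0, hB⟩ := X.exists_dualWeight_le (‖x‖ + 1)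
  refine setLIntegral_lt_top_of_bddAbove measure_ball_lt_top.ne ⟨B.toNNReal, ?_⟩
  rintro _ ⟨y, hy, rfl⟩
  refine Real.toNNReal_le_toNNReal (hB y ?_)
  have := norm_le_norm_add_norm_sub' y x
  rw [← dist_eq_norm] at this
  linarith [Metric.mem_ball.1 hy]

lemma exists_hasCompactSupport_beurlingNorm_sub_le (u : beurlingL1 X.dualWeight) {ε : ℝ}
    (hε : 0 < ε) : ∃ v : beurlingL1 X.dualWeight, Continuous v.1 ∧ HasCompactSupport v.1 ∧
      beurlingNorm X.dualWeight (u - v : beurlingL1 X.dualWeight) ≤ ε := by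
  have := X.isLocallyFinite_withDensity_dualWeight
  have hmeas : Measurable fun x => (X.dualWeight x).toNNReal := X.measurable_dualWeight.real_toNNReal
  have hcoe : ∀ x, ((X.dualWeight x).toNNReal : ℝ) = X.dualWeight x := fun x =>
    Real.coe_toNNReal _ (X.dualWeight_nonneg x)
  have hu : Integrable u.1
      ((volume : Measure (Rd d)).withDensity fun x => ((X.dualWeight x).toNNReal : ENNReal)) := by
    rw [integrable_withDensity_iff_integrable_coe_smul hmeas]
    simp_rw [hcoe]
    exact u.2.2
  obtain ⟨v, hvs, hv, hvc, hvi⟩ := hu.exists_hasCompactSupport_integral_sub_le hε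
  rw [integrable_withDensity_iff_integrable_coe_smul hmeas] at hvi
  simp_rw [hcoe] at hvi
  refine ⟨⟨v, hvc.aestronglyMeasurable, hvi⟩, hvc, hvs, le_trans (le_of_eq ?_) hv⟩
  rw [integral_withDensity_eq_integral_smul hmeas, beurlingNorm]
  refine integral_congr_ae (Eventually.of_forall fun x => ?_)
  change ‖u.1 x - v x‖ * X.dualWeight x = (X.dualWeight x).toNNReal • ‖u.1 x - v x‖
  rw [NNReal.smul_def, hcoe, smul_eq_mul, mul_comm]

/-! ### Strong continuity of translations on convolutions -/

lemma eventually_norm_dualTransl_le :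
    ∃ B : ℝ, ∀ᶠ h in 𝓝 (0 : Rd d), ‖X.dualTransl h‖ ≤ B := by
  obtain ⟨B, -, hB⟩ := X.exists_dualWeight_le 1
  refine ⟨B, ?_⟩
  filter_upwards [Metric.closedBall_mem_nhds (0 : Rd d) one_pos] with h hh
  have := hB (-h) (by simpa using hh)
  rwa [dualWeight, neg_neg] at this

lemma isClosed_strongCont :
    IsClosed {f : StrongDual ℂ E | Tendsto (fun h => X.dualTransl h f) (𝓝 0) (𝓝 f)} := by
  obtain ⟨B, hB⟩ := X.eventually_norm_dualTransl_le
  exact isClosed_setOf_tendsto_apply hB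

variable [CompleteSpace E]

lemma norm_dualConvL_le (u : beurlingL1 X.dualWeight) :
    ‖X.dualConvL u‖ ≤ beurlingNorm X.dualWeight u :=
  ContinuousLinearMap.opNorm_le_bound _
    (integral_nonneg fun x => mul_nonneg (norm_nonneg _) (X.dualWeight_nonneg x))
    fun f => X.norm_dualConv_le u f

lemma dualConvL_sub (u v : beurlingL1 X.dualWeight) :
    X.dualConvL (u - v) = X.dualConvL u - X.dualConvL v := by
  ext1 f
  have h1 := X.dualConv_add_left (u - v) v f
  rw [sub_add_cancel] at h1
  rw [sub_apply, dualConvL_apply, dualConvL_apply, dualConvL_apply, h1, add_sub_cancel_right]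

lemma dualTransl_dualConv_sub_apply (u : beurlingL1 X.dualWeight) (f : StrongDual ℂ E) (h : Rd d)
    (g : E) (hu : Integrable fun y => u.1 (y + h) * f (X.transl y g)) :
    (X.dualTransl h (X.dualConv u f) - X.dualConv u f) g =
      ∫ y, (u.1 (y + h) - u.1 y) * f (X.transl y g) := by
  rw [sub_apply, dualTransl_apply, dualConv_apply, dualConv_apply,
    ← integral_add_right_eq_self _ h]
  simp only [sub_mul]
  rw [integral_sub hu (X.integrable_mul_apply_transl u.2 f g)]
  congr 1
  refine integral_congr_ae (Eventually.of_forall fun y => ?_)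
  simp only [← transl_add, add_neg_cancel_right]

lemma tendsto_dualTransl_mul_dualConvL_of_hasCompactSupport (u : beurlingL1 X.dualWeight)
    (hc : Continuous u.1) (hs : HasCompactSupport u.1) :
    Tendsto (fun h => (X.dualTransl h).comp (X.dualConvL u)) (𝓝 0) (𝓝 (X.dualConvL u)) := by
  obtain ⟨R, hR⟩ := hs.isCompact.isBounded.subset_closedBall (0 : Rd d)
  have hR' : ∀ x, R < ‖x‖ → u.1 x = 0 := fun x hx => by
    by_contra h0
    have := hR (subset_tsupport _ h0)
    rw [mem_closedBall_zero_iff] at this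
    linarith
  obtain ⟨B, hB0, hB⟩ := X.exists_dualWeight_le (R + 1)
  set m : ℝ := volume.real (Metric.closedBall (0 : Rd d) (R + 1)) with hm
  have huc := hs.uniformContinuous_of_continuous hc
  refine tendsto_clm_of_forall_norm_le fun ε hε => ?_
  have hη : 0 < ε / (B * (m + 1)) := by positivity
  obtain ⟨δ, hδ, hδ'⟩ := Metric.uniformContinuous_iff.1 huc _ hη
  filter_upwards [Metric.ball_mem_nhds (0 : Rd d) (lt_min hδ one_pos)] with h hh
  rw [mem_ball_zero_iff, lt_min_iff] at hh
  intro f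
  refine ContinuousLinearMap.opNorm_le_bound _ (by positivity) fun g => ?_
  have hi : Integrable fun y => u.1 (y + h) * f (X.transl y g) := by
    refine (Continuous.integrable_of_hasCompactSupport
      ((hc.comp (continuous_add_const h)).mul (X.continuous_apply_transl f g)) ?_)
    exact (hs.comp_homeomorph (Homeomorph.addRight h)).mul_right
  change ‖(X.dualTransl h (X.dualConv u f) - X.dualConv u f) g‖ ≤ _
  rw [X.dualTransl_dualConv_sub_apply u f h g hi]
  have hset : ∫ y, (u.1 (y + h) - u.1 y) * f (X.transl y g) =
      ∫ y in Metric.closedBall 0 (R + 1), (u.1 (y + h) - u.1 y) * f (X.transl y g) := by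
    rw [setIntegral_eq_integral_of_forall_compl_eq_zero]
    intro y hy
    rw [mem_closedBall_zero_iff, not_le] at hy
    have h1 : R < ‖y + h‖ := by
      have := norm_sub_le (y + h) h
      rw [add_sub_cancel_right] at this
      linarith
    rw [hR' y (by linarith), hR' _ h1]
    simp
  rw [hset]
  have hbd : ∀ y ∈ Metric.closedBall (0 : Rd d) (R + 1),
      ‖(u.1 (y + h) - u.1 y) * f (X.transl y g)‖ ≤
        ε / (B * (m + 1)) * (B * (‖f‖ * ‖g‖)) := by
    intro y hy
    rw [norm_mul, ← dist_eq_norm]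
    have h1 : dist (u.1 (y + h)) (u.1 y) ≤ ε / (B * (m + 1)) :=
      (hδ' (by simpa [dist_eq_norm] using hh.1)).le
    have h2 : ‖f (X.transl y g)‖ ≤ B * (‖f‖ * ‖g‖) :=
      (X.norm_apply_transl_le f g y).trans
        (by gcongr; exact hB y (mem_closedBall_zero_iff.1 hy))
    gcongr
  refine (norm_setIntegral_le_of_norm_le_const measure_closedBall_lt_top hbd).trans ?_
  rw [← hm]
  have hm0 : 0 ≤ m := measureReal_nonneg
  calc _ = (m / (m + 1)) * (ε * ‖f‖ * ‖g‖) := by field_simp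
    _ ≤ _ := mul_le_of_le_one_left (by positivity) ((div_le_one (by positivity)).2 (by linarith))

/-- For `u ∈ L^1_ω̌` the operators `f ↦ T_h (u * f)` tend to `f ↦ u * f` in norm as `h → 0`. -/
lemma tendsto_dualTransl_mul_dualConvL (u : beurlingL1 X.dualWeight) :
    Tendsto (fun h => (X.dualTransl h).comp (X.dualConvL u)) (𝓝 0) (𝓝 (X.dualConvL u)) := by
  obtain ⟨B, hB⟩ := X.eventually_norm_dualTransl_le
  have hcl := isClosed_setOf_tendsto_comp hB
  refine hcl.closure_subset (Metric.mem_closure_iff.2 fun ε hε => ?_)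
  obtain ⟨v, hvc, hvs, hv⟩ := X.exists_hasCompactSupport_beurlingNorm_sub_le u (half_pos hε)
  refine ⟨X.dualConvL v, X.tendsto_dualTransl_mul_dualConvL_of_hasCompactSupport v hvc hvs, ?_⟩
  rw [dist_eq_norm, ← dualConvL_sub]
  exact ((X.norm_dualConvL_le _).trans hv).trans_lt (by linarith)

end TISpace

lemma exists_integrable_hasSum {d : ℕ} {F : ℕ → Rd d → ℂ} (hF : ∀ k, Integrable (F k))
    (hs : Summable fun k => ∫ x, ‖F k x‖) :
    ∃ u : Rd d → ℂ, Integrable u ∧ ∀ᵐ x, HasSum (fun k => F k x) (u x) := by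
  set f : ℕ → Lp ℂ 1 (volume : Measure (Rd d)) := fun k => (hF k).toL1 (F k) with hf
  have hfn : Summable fun k => ‖f k‖ := by
    refine hs.congr fun k => ?_
    rw [L1.norm_eq_integral_norm]
    refine integral_congr_ae ?_
    filter_upwards [(hF k).coeFn_toL1] with x hx
    rw [hx]
  have h1 : ∑' k, ‖f k‖ₑ ≠ ⊤ := by
    rw [tsum_enorm_ne_top_iff_summable_norm]
    exact hfn
  refine ⟨_, L1.integrable_coeFn (∑' k, f k), ?_⟩
  filter_upwards [Lp.hasSum_coeFn_tsum h1, ae_all_iff.2 fun k => (hF k).coeFn_toL1] with x hx hx'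
  simpa only [hf, hx'] using hx

namespace TISpace

variable {W : WeightPair} {c : UltraCase} {d : ℕ}
  {E : Type*} [NormedAddCommGroup E] [NormedSpace ℂ E] (X : TISpace W c d E)

/-- The closed subspace of all `f ∈ E'` with `T_h f → f` as `h → 0`. -/
def strongContSubmodule : Submodule ℂ (StrongDual ℂ E) where
  carrier := {f | Tendsto (fun h => X.dualTransl h f) (𝓝 0) (𝓝 f)}
  zero_mem' := by simp
  add_mem' := by
    intro f g hf hg
    simpa using Tendsto.add hf hg
  smul_mem' := by
    intro a f hf
    simpa using Tendsto.const_smul hf a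

lemma mem_strongContSubmodule {f : StrongDual ℂ E} :
    f ∈ X.strongContSubmodule ↔ Tendsto (fun h => X.dualTransl h f) (𝓝 0) (𝓝 f) := Iff.rfl

/-! ### Approximate identity and factorization -/

/-- A sequence of bump functions with shrinking supports. -/
def bump (d n : ℕ) : ContDiffBump (0 : Rd d) where
  rIn := 1 / (2 * (n + 1))
  rOut := 1 / (n + 1)
  rIn_pos := by positivity
  rIn_lt_rOut := by
    have : (0 : ℝ) < n + 1 := by positivity
    exact one_div_lt_one_div_of_lt this (by linarith)

lemma bump_normed_eq_zero {n : ℕ} {x : Rd d} (hx : 1 / ((n : ℝ) + 1) ≤ ‖x‖) :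
    (bump d n).normed volume x = 0 := by
  have : x ∉ Function.support ((bump d n).normed volume) := by
    rw [ContDiffBump.support_normed_eq, mem_ball_zero_iff]
    exact not_lt.2 hx
  exact Function.notMem_support.1 this

lemma bump_normed_eq_zero_of_one_lt {n : ℕ} {x : Rd d} (hx : 1 < ‖x‖) :
    (bump d n).normed volume x = 0 := by
  refine bump_normed_eq_zero (le_trans ?_ hx.le)
  rw [div_le_one (by positivity)]
  linarith [n.cast_nonneg (α := ℝ)]

lemma norm_bump_normed (n : ℕ) (x : Rd d) :
    ‖(((bump d n).normed volume x : ℝ) : ℂ)‖ = (bump d n).normed volume x := by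
  rw [Complex.norm_real, Real.norm_of_nonneg (ContDiffBump.nonneg_normed _ _)]

/-- The normalized bump functions, which form an approximate identity of `L^1_ω̌`. -/
def approxId (n : ℕ) : beurlingL1 X.dualWeight :=
  ⟨fun x => (((bump d n).normed volume x : ℝ) : ℂ),
    X.mem_beurlingL1_of_support (R := 1) (bump d n).integrable_normed.ofReal fun x hx => by
      rw [bump_normed_eq_zero_of_one_lt hx, Complex.ofReal_zero]⟩

lemma approxId_val (n : ℕ) :
    (X.approxId n).1 = fun x => (((bump d n).normed volume x : ℝ) : ℂ) := rfl

lemma integral_approxId (n : ℕ) : ∫ x, (X.approxId n).1 x = 1 := by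
  rw [approxId_val, integral_complex_ofReal, ContDiffBump.integral_normed, Complex.ofReal_one]

variable [CompleteSpace E]

lemma exists_norm_dualConvL_approxId_le : ∃ C : ℝ, ∀ n, ‖X.dualConvL (X.approxId n)‖ ≤ C := by
  obtain ⟨B, -, hB⟩ := X.exists_dualWeight_le 1
  refine ⟨B, fun n => (X.norm_dualConvL_le _).trans ?_⟩
  have h1 : B = ∫ x, (bump d n).normed volume x * B := by
    rw [integral_mul_const, ContDiffBump.integral_normed, one_mul]
  rw [h1, beurlingNorm]
  refine integral_mono (X.integrable_norm_mul_dualWeight (X.approxId n).2)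
    ((bump d n).integrable_normed.mul_const B) fun x => ?_
  simp only [approxId_val, norm_bump_normed]
  by_cases hx : ‖x‖ ≤ 1
  · exact mul_le_mul_of_nonneg_left (hB x hx) (ContDiffBump.nonneg_normed _ _)
  · rw [bump_normed_eq_zero_of_one_lt (not_le.1 hx), zero_mul, zero_mul]

lemma norm_dualConv_approxId_sub_le (n : ℕ) (f : StrongDual ℂ E) {η : ℝ}
    (h : ∀ y : Rd d, ‖y‖ < 1 / ((n : ℝ) + 1) → ‖X.dualTransl y f - f‖ ≤ η) :
    ‖X.dualConv (X.approxId n) f - f‖ ≤ η := by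
  have h1 := X.norm_smul_sub_dualConv_le (X.approxId n) (bump d n).integrable_normed.ofReal f
    (G := fun y => (bump d n).normed volume y * η) ((bump d n).integrable_normed.mul_const η)
    fun y => by
      simp only [approxId_val, norm_bump_normed]
      rcases lt_or_ge ‖y‖ (1 / ((n : ℝ) + 1)) with hy | hy
      · refine mul_le_mul_of_nonneg_left ?_ (ContDiffBump.nonneg_normed _ _)
        rw [norm_sub_rev]
        exact h (-y) (by rwa [norm_neg])
      · rw [bump_normed_eq_zero hy, zero_mul, zero_mul]
  rwa [integral_approxId, one_smul, norm_sub_rev, integral_mul_const,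
    ContDiffBump.integral_normed, one_mul] at h1

lemma eventually_ball_subset {p : Rd d → Prop} (hp : ∀ᶠ y in 𝓝 0, p y) :
    ∀ᶠ n : ℕ in atTop, ∀ y : Rd d, ‖y‖ < 1 / ((n : ℝ) + 1) → p y := by
  obtain ⟨δ, hδ, hp⟩ := Metric.eventually_nhds_iff.1 hp
  filter_upwards [tendsto_one_div_add_atTop_nhds_zero_nat.eventually (gt_mem_nhds hδ)]
    with n hn y hy
  exact hp (by rw [dist_zero_right]; exact hy.trans hn)

lemma tendsto_dualConv_approxId {f : StrongDual ℂ E} (hf : f ∈ X.strongContSubmodule) :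
    Tendsto (fun n => X.dualConvL (X.approxId n) f) atTop (𝓝 f) := by
  rw [Metric.tendsto_nhds]
  intro ε hε
  filter_upwards [eventually_ball_subset (Metric.tendsto_nhds.1 hf (ε / 2) (half_pos hε))]
    with n hn
  rw [dist_eq_norm]
  refine (X.norm_dualConv_approxId_sub_le n f (η := ε / 2) fun y hy => ?_).trans_lt
    (half_lt_self hε)
  rw [← dist_eq_norm]
  exact (hn y hy).le

lemma tendsto_dualConvL_approxId_mul (u : beurlingL1 X.dualWeight) :
    Tendsto (fun n => X.dualConvL (X.approxId n) * X.dualConvL u) atTop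
      (𝓝 (X.dualConvL u)) := by
  refine tendsto_clm_of_forall_norm_le fun ε hε => ?_
  have h1 := tendsto_clm_iff_norm_sub.1 (X.tendsto_dualTransl_mul_dualConvL u)
  filter_upwards [eventually_ball_subset (h1.eventually (gt_mem_nhds hε))] with n hn f
  refine X.norm_dualConv_approxId_sub_le n (X.dualConv u f) fun y hy => ?_
  exact (ContinuousLinearMap.le_opNorm ((X.dualTransl y).comp (X.dualConvL u) - X.dualConvL u)
    f).trans (mul_le_mul_of_nonneg_right (hn y hy).le (norm_nonneg f))

lemma exists_hasSum_dualConv {a : ℕ → ℝ} (ha : ∀ k, 0 ≤ a k) (hs : Summable a) (φ : ℕ → ℕ)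
    (f : StrongDual ℂ E) : ∃ u : beurlingL1 X.dualWeight,
      ∀ g, HasSum (fun k => (a k : ℂ) * X.dualConv (X.approxId (φ k)) f g) (X.dualConv u f g) := by
  set F : ℕ → Rd d → ℂ := fun k x => (a k : ℂ) * (X.approxId (φ k)).1 x with hFdef
  have hFn : ∀ k x, ‖F k x‖ = a k * (bump d (φ k)).normed volume x := fun k x => by
    rw [hFdef]
    dsimp only
    rw [norm_mul, approxId_val, norm_bump_normed, Complex.norm_real, Real.norm_of_nonneg (ha k)]
  have hF0 : ∀ k x, 1 < ‖x‖ → F k x = 0 := fun k x hx => by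
    rw [← norm_eq_zero, hFn, bump_normed_eq_zero_of_one_lt hx, mul_zero]
  have hFi : ∀ k, Integrable (F k) := fun k =>
    (bump d (φ k)).integrable_normed.ofReal.const_mul _
  have hFint : ∀ k, ∫ x, ‖F k x‖ = a k := fun k => by
    simp_rw [hFn]
    rw [integral_const_mul, ContDiffBump.integral_normed, mul_one]
  obtain ⟨u₀, hu₀, hsum⟩ := exists_integrable_hasSum hFi (by simpa only [hFint] using hs)
  set u : Rd d → ℂ := (Metric.closedBall 0 1).indicator u₀ with hu
  have hu_mem : u ∈ beurlingL1 X.dualWeight :=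
    X.mem_beurlingL1_of_support (R := 1) (hu₀.indicator measurableSet_closedBall) fun x hx =>
      Set.indicator_of_notMem (by simpa using hx) _
  have hsum' : ∀ᵐ x, HasSum (fun k => F k x) (u x) := by
    filter_upwards [hsum] with x hx
    by_cases h1 : ‖x‖ ≤ 1
    · rwa [hu, Set.indicator_of_mem (by simpa using h1)]
    · rw [hu, Set.indicator_of_notMem (by simpa using h1)]
      simp [hF0 _ x (not_le.1 h1)]
  refine ⟨⟨u, hu_mem⟩, fun g => ?_⟩
  obtain ⟨B, hB0, hB⟩ := X.exists_dualWeight_le 1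
  have hle : ∀ k x, ‖F k x * f (X.transl x g)‖ ≤ ‖F k x‖ * (B * (‖f‖ * ‖g‖)) := fun k x => by
    rw [norm_mul]
    by_cases hx : ‖x‖ ≤ 1
    · gcongr
      refine (X.norm_apply_transl_le f g x).trans ?_
      gcongr
      exact hB x hx
    · rw [hF0 k x (not_le.1 hx), norm_zero, zero_mul, zero_mul]
  have hi : ∀ k, Integrable fun x => F k x * f (X.transl x g) := fun k =>
    ((hFi k).norm.mul_const _).mono'
      ((hFi k).1.mul (X.continuous_apply_transl f g).aestronglyMeasurable)
      (Eventually.of_forall (hle k))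
  have hsm : Summable fun k => ∫ x, ‖F k x * f (X.transl x g)‖ := by
    refine Summable.of_nonneg_of_le (fun k => integral_nonneg fun x => norm_nonneg _) (fun k => ?_)
      (hs.mul_right (B * (‖f‖ * ‖g‖)))
    rw [← hFint, ← integral_mul_const]
    exact integral_mono (hi k).norm ((hFi k).norm.mul_const _) (hle k)
  have key := hasSum_integral_of_summable_integral_norm hi hsm
  have e1 : ∫ x, ∑' k, F k x * f (X.transl x g) = X.dualConv ⟨u, hu_mem⟩ f g := by
    rw [dualConv_apply]
    refine integral_congr_ae ?_
    filter_upwards [hsum'] with x hx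
    exact (hx.mul_right _).tsum_eq
  rw [e1] at key
  refine key.congr_fun fun k => ?_
  rw [dualConv_apply, ← integral_const_mul]
  simp only [hFdef, mul_assoc]

lemma dualConv_mem_strongContSubmodule (u : beurlingL1 X.dualWeight) (f : StrongDual ℂ E) :
    X.dualConv u f ∈ X.strongContSubmodule := by
  have h1 := tendsto_clm_iff_norm_sub.1 (X.tendsto_dualTransl_mul_dualConvL u)
  refine tendsto_iff_norm_sub_tendsto_zero.2 (squeeze_zero (fun _ => norm_nonneg _) (fun h => ?_)
    (by simpa using h1.mul_const ‖f‖))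
  exact ContinuousLinearMap.le_opNorm ((X.dualTransl h).comp (X.dualConvL u) - X.dualConvL u) f

/-- `E'_* = L^1_ω̌ * E'` consists of the strongly continuous vectors of `E'`. -/
theorem coe_strongContSubmodule : (X.strongContSubmodule : Set (StrongDual ℂ E)) = X.goodDual := by
  refine Set.Subset.antisymm (fun f hf => ?_) ?_
  · obtain ⟨C, hC⟩ := X.exists_norm_dualConvL_approxId_le
    obtain ⟨a, φ, f₀, ha, hs, hsum⟩ := cohen_factorization hC (X.tendsto_dualConv_approxId hf)
      fun k => X.tendsto_dualConvL_approxId_mul _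
    obtain ⟨u, hu⟩ := X.exists_hasSum_dualConv ha hs φ f₀
    refine ⟨u, f₀, ?_⟩
    ext g
    exact (hsum.mapL (ContinuousLinearMap.apply ℂ ℂ g)).unique (hu g)
  · rintro _ ⟨u, f, rfl⟩
    exact X.dualConv_mem_strongContSubmodule u f

lemma isBanachModule_strongContSubmodule : X.IsBanachModule X.strongContSubmodule where
  mem u f _ := X.dualConv_mem_strongContSubmodule u f
  add_left u v f _ := X.dualConv_add_left u v f
  smul_left a u f _ := X.dualConv_smul_left a u f
  add_right u f _ g _ := map_add (X.dualConvL u) f g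
  smul_right a u f _ := map_smul (X.dualConvL u) a f
  assoc u v := ⟨_, Eventually.of_forall fun _ => rfl, fun f _ => X.dualConv_assoc u v f⟩
  norm_le u f _ := X.norm_dualConv_le u f

end TISpace

/-! ### Decay of test functions -/

lemma WeightPair.pow_div_le_exp_assoc (W : WeightPair) {ρ : ℝ} (hρ : 0 ≤ ρ) (p : ℕ) :
    ρ ^ p / W.A p ≤ Real.exp (W.assoc ρ) := by
  have hA := W.A_pos p
  have h0 : 0 ≤ ρ ^ p / W.A p := by positivity
  rcases h0.eq_or_lt with h | h
  · rw [← h]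
    exact (Real.exp_pos _).le
  · rw [← Real.log_le_iff_le_exp h]
    exact (le_max_right _ _).trans (le_ciSup (W.assoc_bdd ρ) p)

/-- A consequence of `(M.2)`: `2 A(ρ) ≤ A(Hρ) + ln c₀`. -/
lemma WeightPair.exists_exp_assoc_sq_le (W : WeightPair) : ∃ c₀ H : ℝ, 0 < c₀ ∧ 0 < H ∧
    ∀ ρ : ℝ, 0 ≤ ρ → Real.exp (W.assoc ρ) * Real.exp (W.assoc ρ) ≤
      c₀ * Real.exp (W.assoc (H * ρ)) := by
  obtain ⟨c₀, H, hc, hH, hst⟩ := W.A_stable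
  have hc0 : 0 < c₀ := by linarith
  refine ⟨c₀, H, hc0, by linarith, fun ρ hρ => ?_⟩
  have key : W.assoc ρ ≤ (Real.log c₀ + W.assoc (H * ρ)) / 2 := by
    refine ciSup_le fun p => ?_
    have hA := W.A_pos p
    have hA2 := W.A_pos (2 * p)
    have h1 : (ρ ^ p / W.A p) ^ 2 ≤ c₀ * ((H * ρ) ^ (2 * p) / W.A (2 * p)) := by
      have h2 := hst (2 * p) p (by omega)
      rw [show 2 * p - p = p by omega] at h2
      rw [div_pow, ← pow_mul, mul_comm p 2, ← mul_div_assoc, div_le_div_iff₀ (by positivity) hA2]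
      calc _ ≤ ρ ^ (2 * p) * (c₀ * H ^ (2 * p) * (W.A p * W.A p)) := by gcongr
        _ = _ := by rw [mul_pow]; ring
    have h3 : 2 * Real.posLog (ρ ^ p / W.A p) ≤ Real.posLog c₀ + W.assoc (H * ρ) := by
      have h4 := Real.posLog_le_posLog (by positivity) h1
      rw [Real.posLog_pow] at h4
      have h5 := le_ciSup (W.assoc_bdd (H * ρ)) (2 * p)
      exact_mod_cast h4.trans (Real.posLog_mul.trans (add_le_add le_rfl h5))
    rw [Real.posLog_eq_log (x := c₀) (by rwa [abs_of_pos hc0])] at h3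
    linarith
  calc _ = Real.exp (W.assoc ρ + W.assoc ρ) := (Real.exp_add _ _).symm
    _ ≤ Real.exp (Real.log c₀ + W.assoc (H * ρ)) := Real.exp_le_exp.2 (by linarith)
    _ = _ := by rw [Real.exp_add, Real.exp_log hc0]

lemma WeightPair.exists_pow_le_exp_assoc (W : WeightPair) (p : ℕ) {τ : ℝ} (hτ : 0 < τ) :
    ∃ K : ℝ, 0 < K ∧ ∀ ρ : ℝ, 0 ≤ ρ → (1 + ρ) ^ p ≤ K * Real.exp (W.assoc (τ * ρ)) := by
  have hA := W.A_pos p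
  refine ⟨2 ^ p * (1 + W.A p / τ ^ p), by positivity, fun ρ hρ => ?_⟩
  have h1 : (1 + ρ) ^ p ≤ 2 ^ p * (1 + ρ ^ p) := by
    rcases le_total ρ 1 with h | h
    · calc (1 + ρ) ^ p ≤ 2 ^ p := by gcongr; linarith
        _ ≤ 2 ^ p * (1 + ρ ^ p) := le_mul_of_one_le_right (by positivity)
          (by linarith [pow_nonneg hρ p])
    · calc (1 + ρ) ^ p ≤ (2 * ρ) ^ p := by gcongr; linarith
        _ = 2 ^ p * ρ ^ p := mul_pow _ _ _
        _ ≤ 2 ^ p * (1 + ρ ^ p) := by gcongr; linarith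
  refine h1.trans ?_
  rw [mul_assoc]
  gcongr
  rw [add_mul, one_mul]
  gcongr
  · exact Real.one_le_exp (W.assoc_nonneg _)
  · have h2 := W.pow_div_le_exp_assoc (show 0 ≤ τ * ρ by positivity) p
    calc ρ ^ p = W.A p / τ ^ p * ((τ * ρ) ^ p / W.A p) := by rw [mul_pow]; field_simp
      _ ≤ _ := by gcongr

lemma integrable_inv_one_add_norm_pow (d : ℕ) :
    Integrable fun x : Rd d => ((1 + ‖x‖) ^ (d + 1))⁻¹ := by
  have h1 : Integrable fun x : Rd d => (1 + ‖x‖) ^ (-((d + 1 : ℕ) : ℝ)) :=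
    integrable_one_add_norm (by rw [finrank_euclideanSpace_fin]; push_cast; linarith)
  refine h1.congr (Eventually.of_forall fun x => ?_)
  dsimp only
  rw [Real.rpow_neg (by positivity), Real.rpow_natCast]

lemma norm_mul_exp_le_sigma (W : WeightPair) {d : ℕ} {h : Set.Ioi (0 : ℝ)} {φ : Rd d → ℂ}
    (hφ : φ ∈ step W d h) (x : Rd d) :
    ‖φ x‖ * Real.exp (W.assoc (h * ‖x‖)) ≤ sigma W h φ := by
  have h1 := stepTerm_le_sigma W hφ (⟨0, Fin.elim0⟩, x)
  simpa [stepTerm, partialD, W.M_zero, mul_comm] using h1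

lemma exists_index (W : WeightPair) (d : ℕ) : ∃ H : ℝ, 0 < H ∧ ∀ (h : Set.Ioi (0 : ℝ)) (τ : ℝ),
    0 < τ → H * τ ≤ h → ∀ φ ∈ step W d h, ∃ K : ℝ, 0 < K ∧ ∀ x : Rd d,
      ‖φ x‖ * Real.exp (W.assoc (τ * ‖x‖)) ≤ K * ((1 + ‖x‖) ^ (d + 1))⁻¹ := by
  obtain ⟨c₀, H, hc, hH, hsq⟩ := W.exists_exp_assoc_sq_le
  refine ⟨H, hH, fun h τ hτ hle φ hφ => ?_⟩
  obtain ⟨K, hK, hpow⟩ := W.exists_pow_le_exp_assoc (d + 1) hτ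
  have hs := sigma_nonneg W h φ
  refine ⟨K * c₀ * (sigma W h φ + 1), by positivity, fun x => ?_⟩
  rw [← div_eq_mul_inv, le_div_iff₀ (by positivity)]
  calc _ ≤ ‖φ x‖ * Real.exp (W.assoc (τ * ‖x‖)) * (K * Real.exp (W.assoc (τ * ‖x‖))) := by
        gcongr
        exact hpow _ (norm_nonneg x)
    _ = K * ‖φ x‖ * (Real.exp (W.assoc (τ * ‖x‖)) * Real.exp (W.assoc (τ * ‖x‖))) := by ring
    _ ≤ K * ‖φ x‖ * (c₀ * Real.exp (W.assoc (H * (τ * ‖x‖)))) := by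
        exact mul_le_mul_of_nonneg_left (hsq _ (by positivity)) (by positivity)
    _ ≤ K * ‖φ x‖ * (c₀ * Real.exp (W.assoc (h * ‖x‖))) := by
        gcongr
        refine W.assoc_mono (by positivity) ?_
        rw [← mul_assoc]
        gcongr
    _ = K * c₀ * (‖φ x‖ * Real.exp (W.assoc (h * ‖x‖))) := by ring
    _ ≤ _ := by
        gcongr
        linarith [norm_mul_exp_le_sigma W hφ x]

namespace TestSpace

variable {W : WeightPair} {c : UltraCase} {d : ℕ}

lemma exists_mem_step (φ : TestSpace W c d) : ∃ h, φ.1 ∈ step W d h := by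
  cases c with
  | beurling => exact ⟨⟨1, Set.mem_Ioi.2 one_pos⟩, (Submodule.mem_iInf _).1 φ.2 _⟩
  | roumieu => exact (mem_roumieu_iff W d _).1 φ.2

lemma contDiff (φ : TestSpace W c d) : ContDiff ℝ ∞ φ.1 := φ.exists_mem_step.choose_spec.1

lemma exists_norm_le (φ : TestSpace W c d) : ∃ K : ℝ, 0 < K ∧ ∀ x : Rd d,
    ‖φ x‖ ≤ K * ((1 + ‖x‖) ^ (d + 1))⁻¹ := by
  obtain ⟨h, hφ⟩ := φ.exists_mem_step
  have h0 : (0 : ℝ) < h := h.2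
  obtain ⟨H, hH, hdec⟩ := exists_index W d
  obtain ⟨K, hK0, hK⟩ := hdec h (h / H) (by positivity) (by rw [mul_div_cancel₀ _ hH.ne']) _ hφ
  exact ⟨K, hK0, fun x => (le_mul_of_one_le_right (norm_nonneg _)
    (Real.one_le_exp (W.assoc_nonneg _))).trans (hK x)⟩

lemma integrable (φ : TestSpace W c d) : Integrable φ.1 := by
  obtain ⟨K, -, hK⟩ := φ.exists_norm_le
  exact ((integrable_inv_one_add_norm_pow d).const_mul K).mono'
    φ.contDiff.continuous.aestronglyMeasurable (Eventually.of_forall hK)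

end TestSpace

namespace TISpace

variable {W : WeightPair} {c : UltraCase} {d : ℕ}
  {E : Type*} [NormedAddCommGroup E] [NormedSpace ℂ E] (X : TISpace W c d E)

lemma exists_norm_mul_dualWeight_le (φ : TestSpace W c d) {r : ℝ} (hr : 0 < r) :
    ∃ K : ℝ, 0 < K ∧ ∀ x y : Rd d, ‖y‖ ≤ r * ‖x‖ →
      ‖φ x‖ * X.dualWeight y ≤ K * ((1 + ‖x‖) ^ (d + 1))⁻¹ := by
  obtain ⟨H, hH, hdec⟩ := exists_index W d
  have key : ∃ τ : ℝ, 0 < τ ∧ ∃ C : ℝ, 0 < C ∧ TranslationBound X.emb τ C ∧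
      ∃ h : Set.Ioi (0 : ℝ), H * (τ * r) ≤ h ∧ φ.1 ∈ step W d h := by
    have hax := X.axiomIII
    cases c with
    | beurling =>
      obtain ⟨τ, hτ, C, hC, hb⟩ := hax
      exact ⟨τ, hτ, C, hC, hb, ⟨H * (τ * r), by simp only [Set.mem_Ioi]; positivity⟩, le_rfl,
        (Submodule.mem_iInf _).1 φ.2 _⟩
    | roumieu =>
      obtain ⟨h, hφ⟩ := φ.exists_mem_step
      have h0 : (0 : ℝ) < h := h.2
      obtain ⟨C, hC, hb⟩ := hax (h / (H * r)) (by positivity)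
      exact ⟨h / (H * r), by positivity, C, hC, hb, h, le_of_eq (by field_simp), hφ⟩
  obtain ⟨τ, hτ, C, hC, hb, h, hh, hφ⟩ := key
  obtain ⟨K, hK0, hK⟩ := hdec h (τ * r) (by positivity) hh _ hφ
  refine ⟨C * K, by positivity, fun x y hxy => ?_⟩
  calc _ ≤ ‖φ x‖ * (C * Real.exp (W.assoc (τ * ‖y‖))) := by
        gcongr
        exact X.dualWeight_le_of_bound hC.le hb y
    _ ≤ ‖φ x‖ * (C * Real.exp (W.assoc (τ * r * ‖x‖))) := by
        gcongr
        refine W.assoc_mono (by positivity) ?_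
        rw [mul_assoc]
        gcongr
    _ = C * (‖φ x‖ * Real.exp (W.assoc (τ * r * ‖x‖))) := by ring
    _ ≤ C * (K * ((1 + ‖x‖) ^ (d + 1))⁻¹) := 
        mul_le_mul_of_nonneg_left (hK x) hC.le
    _ = _ := by ring

/-! ### Mollifiers -/

lemma mollifier_mem (φ : TestSpace W c d) {ε : ℝ} (hε : 0 < ε) :
    mollifier φ ε ∈ beurlingL1 X.dualWeight := by
  have hc := φ.contDiff.continuous
  obtain ⟨K, -, hK⟩ := X.exists_norm_mul_dualWeight_le φ hε
  have h1 : Integrable fun z : Rd d => ‖φ z‖ * X.dualWeight (ε • z) := by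
    refine ((integrable_inv_one_add_norm_pow d).const_mul K).mono'
      (hc.norm.aestronglyMeasurable.mul
        (X.measurable_dualWeight.comp (measurable_const_smul ε)).aestronglyMeasurable)
      (Eventually.of_forall fun z => ?_)
    rw [norm_mul, norm_norm, Real.norm_of_nonneg (X.dualWeight_nonneg _)]
    exact hK z _ (by rw [norm_smul, Real.norm_of_nonneg hε.le])
  refine X.mem_beurlingL1_of_integrable
    (Continuous.aestronglyMeasurable
      ((hc.comp (continuous_const_smul ε⁻¹)).const_smul (ε ^ d)⁻¹))
    (((h1.comp_smul (inv_ne_zero hε.ne')).const_mul (ε ^ d)⁻¹).congr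
      (Eventually.of_forall fun x => ?_))
  simp only [mollifier, norm_smul, smul_inv_smul₀ hε.ne']
  rw [Real.norm_of_nonneg (by positivity), mul_assoc]

lemma integral_scaled {F : Type*} [NormedAddCommGroup F] [NormedSpace ℝ F] (g : Rd d → F) {ε : ℝ}
    (hε : 0 < ε) : ∫ x, (ε ^ d)⁻¹ • g (ε⁻¹ • x) = ∫ x, g x := by
  rw [integral_smul, Measure.integral_comp_inv_smul_of_nonneg _ _ hε.le,
    finrank_euclideanSpace_fin, smul_smul, inv_mul_cancel₀ (by positivity), one_smul]

/-- For a strongly continuous vector `f` the map `h ↦ T_h f` is continuous. -/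
lemma continuous_dualTransl {f : StrongDual ℂ E} (hf : f ∈ X.strongContSubmodule) :
    Continuous fun h => X.dualTransl h f := by
  refine continuous_iff_continuousAt.2 fun k => ?_
  have h1 : Tendsto (fun h : Rd d => h - k) (𝓝 k) (𝓝 0) := by
    have : Continuous fun h : Rd d => h - k := by fun_prop
    simpa using this.tendsto k
  have h2 := ((X.dualTransl k).continuous.tendsto f).comp (Tendsto.comp hf h1)
  refine h2.congr fun h => ?_
  simp [← X.dualTransl_add]

lemma tendsto_mollifier (φ : TestSpace W c d) {f : StrongDual ℂ E}
    (hf : f ∈ X.strongContSubmodule) :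
    Tendsto (fun ε : ℝ => ∫ z, ‖φ z‖ * ‖f - X.dualTransl (-(ε • z)) f‖) (𝓝[>] 0) (𝓝 0) ∧
      ∀ᶠ ε : ℝ in 𝓝[>] 0, Integrable fun z : Rd d =>
        ‖φ z‖ * ‖f - X.dualTransl (-(ε • z)) f‖ := by
  have hc := φ.contDiff.continuous
  obtain ⟨K, hK0, hK⟩ := X.exists_norm_mul_dualWeight_le φ one_pos
  obtain ⟨K', hK0', hK'⟩ := φ.exists_norm_le
  set b : Rd d → ℝ := fun z => (K + K') * ‖f‖ * ((1 + ‖z‖) ^ (d + 1))⁻¹ with hb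
  have hbi : Integrable b := (integrable_inv_one_add_norm_pow d).const_mul _
  have hT := X.continuous_dualTransl hf
  have hmeas : ∀ ε : ℝ, AEStronglyMeasurable
      (fun z : Rd d => ‖φ z‖ * ‖f - X.dualTransl (-(ε • z)) f‖) volume := fun ε =>
    (hc.norm.mul (continuous_const.sub
      (hT.comp (continuous_const_smul ε).neg)).norm).aestronglyMeasurable
  have hle : ∀ᶠ ε : ℝ in 𝓝[>] 0, ∀ z : Rd d,
      ‖‖φ z‖ * ‖f - X.dualTransl (-(ε • z)) f‖‖ ≤ b z := by
    filter_upwards [Ioo_mem_nhdsGT (show (0 : ℝ) < 1 from one_pos)] with ε hε z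
    have h1 : ‖ε • z‖ ≤ 1 * ‖z‖ := by
      rw [norm_smul, Real.norm_of_nonneg hε.1.le]
      gcongr
      exact hε.2.le
    have h2 : ‖f - X.dualTransl (-(ε • z)) f‖ ≤ ‖f‖ + X.dualWeight (ε • z) * ‖f‖ := by
      refine (norm_sub_le _ _).trans (add_le_add le_rfl ?_)
      have := X.norm_dualTransl_le (-(ε • z)) f
      rwa [neg_neg] at this
    rw [norm_mul, norm_norm, norm_norm]
    calc _ ≤ ‖φ z‖ * (‖f‖ + X.dualWeight (ε • z) * ‖f‖) := by gcongr
      _ = ‖φ z‖ * ‖f‖ + ‖φ z‖ * X.dualWeight (ε • z) * ‖f‖ := by ring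
      _ ≤ K' * ((1 + ‖z‖) ^ (d + 1))⁻¹ * ‖f‖ + K * ((1 + ‖z‖) ^ (d + 1))⁻¹ * ‖f‖ := by
          exact add_le_add (mul_le_mul_of_nonneg_right (hK' z) (norm_nonneg f))
            (mul_le_mul_of_nonneg_right (hK z _ h1) (norm_nonneg f))
      _ = b z := by rw [hb]; ring
  refine ⟨?_, hle.mono fun ε h => hbi.mono' (hmeas ε) (Eventually.of_forall h)⟩
  have := tendsto_integral_filter_of_dominated_convergence b
    (Eventually.of_forall hmeas) (hle.mono fun ε h => Eventually.of_forall h) hbi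
    (f := fun _ : Rd d => (0 : ℝ)) (Eventually.of_forall fun z => ?_)
  · simpa using this
  · have h1 : Continuous fun ε : ℝ => ‖φ z‖ * ‖f - X.dualTransl (-(ε • z)) f‖ :=
      continuous_const.mul (continuous_const.sub
        (hT.comp (continuous_id.smul continuous_const).neg)).norm
    have h2 := (h1.tendsto 0).mono_left (nhdsWithin_le_nhds (s := Set.Ioi 0))
    have h3 : X.dualTransl 0 f = f := by
      ext g
      rw [dualTransl_apply, neg_zero, transl_zero]
    simpa [h3] using h2

variable [CompleteSpace E]

lemma norm_smul_sub_mollifier_le (φ : TestSpace W c d) {ε : ℝ} (hε : 0 < ε) {f : StrongDual ℂ E}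
    (hi : Integrable fun z : Rd d => ‖φ z‖ * ‖f - X.dualTransl (-(ε • z)) f‖) :
    ‖(∫ x, φ x) • f - X.dualConv ⟨mollifier φ ε, X.mollifier_mem φ hε⟩ f‖ ≤
      ∫ z, ‖φ z‖ * ‖f - X.dualTransl (-(ε • z)) f‖ := by
  have h1 : Integrable (mollifier φ ε) :=
    (φ.integrable.comp_smul (inv_ne_zero hε.ne')).smul (ε ^ d)⁻¹
  have h2 := X.norm_smul_sub_dualConv_le ⟨mollifier φ ε, X.mollifier_mem φ hε⟩ h1 f
    ((hi.comp_smul (inv_ne_zero hε.ne')).smul (ε ^ d)⁻¹) fun y => by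
      simp only [mollifier, Pi.smul_apply, norm_smul, smul_inv_smul₀ hε.ne', smul_eq_mul]
      rw [Real.norm_of_nonneg (by positivity), mul_assoc]
  have e1 : ∫ x, mollifier φ ε x = ∫ x, φ x := integral_scaled φ.1 hε
  have e2 := integral_scaled (fun z : Rd d => ‖φ z‖ * ‖f - X.dualTransl (-(ε • z)) f‖) hε
  rw [← e1, ← e2]
  exact h2

theorem exists_mollifier_tendsto (φ : TestSpace W c d) :
    ∃ u : ℝ → beurlingL1 X.dualWeight,
      (∀ ε : ℝ, 0 < ε → (u ε : Rd d → ℂ) = mollifier φ ε) ∧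
      ∀ f ∈ X.strongContSubmodule, Tendsto
        (fun ε => ‖(∫ x, φ x) • f - X.dualConv (u ε) f‖) (𝓝[>] 0) (𝓝 0) := by
  classical
  refine ⟨fun ε => if hε : 0 < ε then ⟨mollifier φ ε, X.mollifier_mem φ hε⟩ else 0,
    fun ε hε => by simp only [dif_pos hε], fun f hf => ?_⟩
  obtain ⟨h1, h2⟩ := X.tendsto_mollifier φ hf
  refine squeeze_zero' (Eventually.of_forall fun ε => norm_nonneg _) ?_ h1
  filter_upwards [h2, self_mem_nhdsWithin] with ε h3 hε
  rw [dif_pos (Set.mem_Ioi.1 hε)]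
  exact X.norm_smul_sub_mollifier_le φ hε h3

end TISpace

lemma exists_dual_of_notMem {Z : Type*} [NormedAddCommGroup Z] [NormedSpace ℂ Z]
    {V : Submodule ℂ Z} (hV : IsClosed (V : Set Z)) {z : Z} (hz : z ∉ V) :
    ∃ Φ : StrongDual ℂ Z, Φ z ≠ 0 ∧ ∀ v ∈ V, Φ v = 0 := by
  obtain ⟨Φ, hΦ⟩ := SeparatingDual.exists_ne_zero (R := ℂ) (x := V.mkQ z) (by simpa using hz)
  refine ⟨Φ.comp V.mkQL, hΦ, fun v hv => ?_⟩
  change Φ (V.mkQ v) = 0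
  rw [Submodule.mkQ_apply, (Submodule.Quotient.mk_eq_zero V).2 hv, map_zero]

/-! ### Continuity of seminorms -/

lemma stepTerm_mono (W : WeightPair) {d : ℕ} {h k : ℝ} (hh : 0 < h) (hhk : h ≤ k) (φ : Rd d → ℂ)
    (i : (Σ n : ℕ, Fin n → Fin d) × Rd d) : stepTerm W h φ i ≤ stepTerm W k φ i := by
  have := W.M_pos i.1.1
  have hk : 0 < k := hh.trans_le hhk
  unfold stepTerm
  have hA : W.assoc (h * ‖i.2‖) ≤ W.assoc (k * ‖i.2‖) :=
    W.assoc_mono (by positivity) (by gcongr)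
  gcongr

lemma sigma_mono (W : WeightPair) {d : ℕ} {h k : Set.Ioi (0 : ℝ)} (hhk : h ≤ k) {φ : Rd d → ℂ}
    (hφ : φ ∈ step W d k) : sigma W h φ ≤ sigma W k φ :=
  Real.iSup_le (fun i => (stepTerm_mono W h.2 hhk φ i).trans (stepTerm_le_sigma W hφ i))
    (sigma_nonneg W k φ)

lemma sigma_smul (W : WeightPair) {d : ℕ} (h : Set.Ioi (0 : ℝ)) {φ : Rd d → ℂ}
    (hφ : ContDiff ℝ ∞ φ) (a : ℂ) : sigma W h (a • φ) = ‖a‖ * sigma W h φ := by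
  unfold sigma
  rw [Real.mul_iSup_of_nonneg (norm_nonneg a)]
  simp_rw [stepTerm_smul W h hφ]

lemma eq_zero_of_sigma_eq_zero (W : WeightPair) {d : ℕ} {h : Set.Ioi (0 : ℝ)} {φ : Rd d → ℂ}
    (hφ : φ ∈ step W d h) (h0 : sigma W h φ = 0) : φ = 0 := by
  funext x
  have h1 := norm_mul_exp_le_sigma W hφ x
  rw [h0] at h1
  have h2 : ‖φ x‖ ≤ 0 := nonpos_of_mul_nonpos_left h1 (Real.exp_pos _)
  simpa using h2

lemma partialD_conj {d : ℕ} (φ : Rd d → ℂ) {n : ℕ} (s : Fin n → Fin d) (x : Rd d) :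
    partialD (fun y => (starRingEnd ℂ) (φ y)) s x = (starRingEnd ℂ) (partialD φ s x) := by
  unfold partialD
  have := ContinuousLinearEquiv.iteratedFDeriv_comp_left (𝕜 := ℝ) (f := φ) (x := x)
    Complex.conjCLE (i := n)
  change iteratedFDeriv ℝ n (Complex.conjCLE ∘ φ) x _ = _
  rw [this]
  rfl

lemma conj_mem_step (W : WeightPair) {d : ℕ} {h : Set.Ioi (0 : ℝ)} {φ : Rd d → ℂ}
    (hφ : φ ∈ step W d h) : (fun y => (starRingEnd ℂ) (φ y)) ∈ step W d h := by
  refine ⟨Complex.conjCLE.contDiff.comp hφ.1, sigma W h φ, ?_⟩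
  rintro _ ⟨i, rfl⟩
  refine le_trans (le_of_eq ?_) (stepTerm_le_sigma W hφ i)
  unfold stepTerm
  rw [partialD_conj, RCLike.norm_conj]

namespace TestSpace

variable {W : WeightPair} {c : UltraCase} {d : ℕ}

/-- The complex conjugate of a test function. -/
def conj (φ : TestSpace W c d) : TestSpace W c d :=
  ⟨fun y => (starRingEnd ℂ) (φ y), by
    cases c with
    | beurling => exact (Submodule.mem_iInf _).2 fun h =>
        conj_mem_step W ((Submodule.mem_iInf _).1 φ.2 h)
    | roumieu =>
      obtain ⟨h, hφ⟩ := (mem_roumieu_iff W d _).1 φ.2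
      exact (mem_roumieu_iff W d _).2 ⟨h, conj_mem_step W hφ⟩⟩

lemma eq_zero_of_integral_conj_mul (φ : TestSpace W c d) (h : ∫ x, φ.conj x * φ x = 0) :
    φ = 0 := by
  have hc := φ.contDiff.continuous
  have e1 : ∀ x, φ.conj x * φ x = ((‖φ x‖ ^ 2 : ℝ) : ℂ) := fun x => by
    change (starRingEnd ℂ) (φ x) * φ x = _
    rw [Complex.conj_mul']
    push_cast
    rfl
  simp_rw [e1] at h
  rw [integral_complex_ofReal, Complex.ofReal_eq_zero] at h
  obtain ⟨K, hK0, hK⟩ := φ.exists_norm_le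
  have hb : ∀ x, ‖φ x‖ ≤ K := fun x => (hK x).trans
    (mul_le_of_le_one_right hK0.le (inv_le_one_of_one_le₀
      (one_le_pow₀ (by linarith [norm_nonneg x]))))
  have hi : Integrable fun x => ‖φ x‖ ^ 2 := by
    refine (φ.integrable.norm.const_mul K).mono' (hc.norm.pow 2).aestronglyMeasurable
      (Eventually.of_forall fun x => ?_)
    rw [Real.norm_of_nonneg (by positivity), pow_two]
    exact mul_le_mul_of_nonneg_right (hb x) (norm_nonneg _)
  rw [integral_eq_zero_iff_of_nonneg (fun x => by positivity) hi] at h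
  have h2 := (Continuous.ae_eq_iff_eq volume (hc.norm.pow 2) continuous_const).1 h
  refine Subtype.ext (funext fun x => ?_)
  have h3 : ‖φ x‖ ^ 2 = 0 := congrFun h2 x
  exact norm_eq_zero.1 (pow_eq_zero_iff two_ne_zero |>.1 h3)

lemma isVonNBounded_sigma_le_one (h : Set.Ioi (0 : ℝ)) :
    Bornology.IsVonNBounded ℂ
      {φ : TestSpace W .roumieu d | φ.1 ∈ step W d h ∧ sigma W h φ.1 ≤ 1} := by
  rw [withSeminorms.isVonNBounded_iff_seminorm_bounded]
  rintro ⟨q, hq⟩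
  obtain ⟨C, hC⟩ := hq h
  refine ⟨|C| + 1, by positivity, fun φ hφ => ?_⟩
  calc q φ ≤ C * sigma W h φ.1 := hC φ hφ.1
    _ ≤ |C| * 1 := mul_le_mul (le_abs_self C) hφ.2 (sigma_nonneg W h _) (abs_nonneg C)
    _ < _ := by linarith

/-- The index `n + 1`. -/
def natIdx (n : ℕ) : Set.Ioi (0 : ℝ) := ⟨n + 1, Set.mem_Ioi.2 n.cast_add_one_pos⟩

lemma coe_natIdx (n : ℕ) : (natIdx n : ℝ) = n + 1 := rfl

lemma isVonNBounded_range {ψ : ℕ → TestSpace W .beurling d}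
    (hψ : ∀ n : ℕ, sigma W (natIdx n) (ψ n).1 ≤ 1) :
    Bornology.IsVonNBounded ℂ (Set.range ψ) := by
  rw [withSeminorms.isVonNBounded_iff_seminorm_bounded]
  rintro ⟨q, h, C, hC⟩
  obtain ⟨N, hN⟩ := exists_nat_ge (h : ℝ)
  have hsum : 0 ≤ ∑ n ∈ Finset.range N, q (ψ n) := Finset.sum_nonneg fun n _ => apply_nonneg q _
  refine ⟨|C| + ∑ n ∈ Finset.range N, q (ψ n) + 1, by positivity, ?_⟩
  rintro _ ⟨n, rfl⟩
  change q (ψ n) < _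
  rcases lt_or_ge n N with hn | hn
  · have h1 := Finset.single_le_sum (f := fun n => q (ψ n)) (fun n _ => apply_nonneg q _)
      (Finset.mem_range.2 hn)
    linarith [abs_nonneg C]
  · have hle : h ≤ natIdx n := by
      have : (N : ℝ) ≤ n := by exact_mod_cast hn
      rw [← Subtype.coe_le_coe, coe_natIdx]
      linarith
    have h1 : sigma W h (ψ n).1 ≤ 1 :=
      (sigma_mono W hle ((Submodule.mem_iInf _).1 (ψ n).2 _)).trans (hψ n)
    have h2 : q (ψ n) ≤ |C| * 1 := (hC _).trans
      (mul_le_mul (le_abs_self C) h1 (sigma_nonneg W h _) (abs_nonneg C))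
    linarith

/-- The space `S^*_†(ℝ^d)` is bornological: seminorms that are bounded on bounded sets are
continuous. -/
lemma isContSeminorm_of_bounded (p : Seminorm ℂ (TestSpace W c d))
    (hp : ∀ S, Bornology.IsVonNBounded ℂ S → ∃ C : ℝ, ∀ φ ∈ S, p φ ≤ C) : IsContSeminorm c p := by
  cases c with
  | roumieu =>
    intro h
    obtain ⟨C, hC⟩ := hp _ (isVonNBounded_sigma_le_one h)
    refine ⟨C, fun φ hφ => ?_⟩
    rcases (sigma_nonneg W h φ.1).eq_or_lt with h0 | h0
    · have : φ = 0 := Subtype.ext (eq_zero_of_sigma_eq_zero W hφ h0.symm)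
      rw [← h0, this, map_zero, mul_zero]
    · have hn : ‖(((sigma W h φ.1)⁻¹ : ℝ) : ℂ)‖ = (sigma W h φ.1)⁻¹ := by
        rw [Complex.norm_real, Real.norm_of_nonneg (by positivity)]
      have h1 := hC ((((sigma W h φ.1)⁻¹ : ℝ) : ℂ) • φ) ⟨Submodule.smul_mem _ _ hφ, by
        change sigma W h ((((sigma W h φ.1)⁻¹ : ℝ) : ℂ) • φ.1) ≤ 1
        rw [sigma_smul W h hφ.1, hn, inv_mul_cancel₀ h0.ne']⟩
      rwa [map_smul_eq_mul, hn, inv_mul_le_iff₀ h0, mul_comm] at h1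
  | beurling =>
    by_contra hcon
    have hcon' : ∀ n : ℕ, ∃ φ : TestSpace W .beurling d, ((n : ℝ) + 1) *
        sigma W (natIdx n) φ.1 < p φ := fun n => by
      by_contra! h1
      exact hcon ⟨_, _, h1⟩
    choose φ hφ using hcon'
    have hn1 : ∀ n : ℕ, (0 : ℝ) < n + 1 := fun n => n.cast_add_one_pos
    have hpos : ∀ n, 0 < p (φ n) := fun n =>
      (mul_nonneg (hn1 n).le (sigma_nonneg W (natIdx n) _)).trans_lt (hφ n)
    set a : ℕ → ℝ := fun n => (n + 1) / p (φ n) with ha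
    have hapos : ∀ n, 0 < a n := fun n => div_pos (hn1 n) (hpos n)
    have han : ∀ n, ‖(a n : ℂ)‖ = a n := fun n => by
      rw [Complex.norm_real, Real.norm_of_nonneg (hapos n).le]
    obtain ⟨C, hC⟩ := hp _ (isVonNBounded_range (ψ := fun n => (a n : ℂ) • φ n) fun n => by
      change sigma W (natIdx n) ((a n : ℂ) • (φ n).1) ≤ 1
      rw [sigma_smul W (natIdx n) (φ n).contDiff, han, ha]
      dsimp only
      rw [div_mul_eq_mul_div, div_le_one (hpos n)]
      exact (hφ n).le)
    obtain ⟨n, hn⟩ := exists_nat_ge C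
    have h1 := hC _ ⟨n, rfl⟩
    rw [map_smul_eq_mul, han, ha] at h1
    dsimp only at h1
    rw [div_mul_cancel₀ _ (hpos n).ne'] at h1
    linarith

end TestSpace

namespace TISpace

variable {W : WeightPair} {c : UltraCase} {d : ℕ}
  {E : Type*} [NormedAddCommGroup E] [NormedSpace ℂ E] (X : TISpace W c d E)

/-! ### The inclusion of the test functions into the dual -/

/-- The functional `g ↦ ⟨g, φ⟩` on `E`, for a test function `φ`. -/
def testFunctional (φ : TestSpace W c d) : StrongDual ℂ E where
  toFun g := X.emb g φ
  map_add' g₁ g₂ := by rw [map_add]; rfl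
  map_smul' a g := by rw [map_smul]; rfl
  cont := (continuous_eval_const φ).comp X.emb.continuous

/-- The inclusion `S^*_†(ℝ^d) → E'`, as a linear map. -/
def dualInclₗ : TestSpace W c d →ₗ[ℂ] StrongDual ℂ E where
  toFun := X.testFunctional
  map_add' φ ψ := by ext g; exact map_add (X.emb g) φ ψ
  map_smul' a φ := by ext g; exact map_smul (X.emb g) a φ

lemma exists_norm_testFunctional_le {S : Set (TestSpace W c d)}
    (hS : Bornology.IsVonNBounded ℂ S) : ∃ C : ℝ, ∀ φ ∈ S, ‖X.testFunctional φ‖ ≤ C := by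
  have h1 := ContinuousLinearMap.eventually_nhds_zero_mapsTo (σ := RingHom.id ℂ) hS
    (Metric.closedBall_mem_nhds (0 : ℂ) one_pos)
  have h2 : Tendsto X.emb (𝓝 0) (𝓝 0) := by
    simpa using X.emb.continuous.tendsto 0
  obtain ⟨r, hr, hball⟩ := Metric.nhds_basis_closedBall.eventually_iff.1 (h2.eventually h1)
  refine ⟨1 / r, fun φ hφ => ContinuousLinearMap.opNorm_bound_of_ball_bound hr 1 _ fun g hg => ?_⟩
  have := hball hg hφ
  rwa [mem_closedBall_zero_iff] at this

/-- The inclusion `S^*_†(ℝ^d) → E'`. -/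
def dualIncl : TestSpace W c d →L[ℂ] StrongDual ℂ E where
  toLinearMap := X.dualInclₗ
  cont := by
    refine TestSpace.withSeminorms.continuous_normedSpace_rng (StrongDual ℂ E) X.dualInclₗ
      ⟨({⟨(normSeminorm ℂ (StrongDual ℂ E)).comp X.dualInclₗ,
        TestSpace.isContSeminorm_of_bounded _ fun S hS => X.exists_norm_testFunctional_le hS⟩} :
        Finset {p : Seminorm ℂ (TestSpace W c d) // TestSpace.IsContSeminorm c p}), 1, ?_⟩
    rw [one_smul, Finset.sup_singleton]
    rfl

lemma dualIncl_apply (φ : TestSpace W c d) (g : E) : X.dualIncl φ g = X.emb g φ := rfl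

lemma dualTransl_dualIncl (h : Rd d) (φ : TestSpace W c d) :
    X.dualTransl h (X.dualIncl φ) = X.dualIncl (TestSpace.translate W c h φ) := by
  ext g
  rw [dualTransl_apply, dualIncl_apply, dualIncl_apply, emb_transl]
  change X.emb g (TestSpace.translate W c (- -h) φ) = _
  rw [neg_neg]

lemma dualIncl_mem (φ : TestSpace W c d) : X.dualIncl φ ∈ X.strongContSubmodule := by
  rw [mem_strongContSubmodule]
  simp_rw [X.dualTransl_dualIncl]
  exact (X.dualIncl.continuous.tendsto φ).comp (TestSpace.tendsto_translate φ)

lemma dualEmb_dualIncl (φ ψ : TestSpace W c d) :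
    X.dualEmb (X.dualIncl φ) ψ = ∫ x, φ x * ψ x := by
  change X.emb (X.incl ψ) φ = _
  rw [X.isInclusion]
  simp_rw [mul_comm]

lemma dualIncl_injective : Function.Injective X.dualIncl := by
  refine (injective_iff_map_eq_zero X.dualIncl).2 fun φ hφ => ?_
  refine φ.eq_zero_of_integral_conj_mul ?_
  rw [← X.isInclusion, ← dualIncl_apply, hφ]
  rfl

lemma dualEmb_injective : Function.Injective X.dualEmb := by
  intro f₁ f₂ h
  refine DFunLike.coe_injective (X.denseRange_incl.equalizer f₁.continuous f₂.continuous ?_)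
  funext φ
  exact congrArg (fun T : Ultradistribution W c d => T φ) h

theorem axiomA'_strongContSubmodule :
    AxiomA' (F := X.strongContSubmodule) (X.subEmb X.strongContSubmodule) := by
  refine ⟨⟨X.dualIncl.codRestrict _ X.dualIncl_mem, fun φ ψ => X.dualEmb_dualIncl φ ψ,
    fun φ ψ h => X.dualIncl_injective (congrArg Subtype.val h)⟩,
    X.dualEmb_injective.comp Subtype.val_injective, ?_⟩
  refine (X.denseRange_emb.comp X.denseRange_incl X.emb.continuous).mono ?_
  rintro _ ⟨φ, rfl⟩
  refine ⟨⟨X.dualIncl φ, X.dualIncl_mem φ⟩, ?_⟩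
  ext ψ
  change X.dualEmb (X.dualIncl φ) ψ = X.emb (X.incl φ) ψ
  rw [X.dualEmb_dualIncl, X.isInclusion]

lemma dualTransl_mem (h : Rd d) {f : StrongDual ℂ E} (hf : f ∈ X.strongContSubmodule) :
    X.dualTransl h f ∈ X.strongContSubmodule := by
  rw [mem_strongContSubmodule]
  simp_rw [X.dualTransl_comm _ h f]
  exact ((X.dualTransl h).continuous.tendsto f).comp hf

theorem axiomIIStrong_strongContSubmodule :
    AxiomIIStrong (F := X.strongContSubmodule) (X.subEmb X.strongContSubmodule) := by
  refine ⟨fun h => ((X.dualTransl h).comp X.strongContSubmodule.subtypeL).codRestrict _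
    fun f => X.dualTransl_mem h f.2, fun h f => X.dualEmb_dualTransl h f, fun f => ?_⟩
  exact (X.continuous_dualTransl f.2).subtype_mk _

lemma translationBound_subEmb {τ C : ℝ} (hC : 0 ≤ C) (hb : TranslationBound X.emb τ C)
    (V : Submodule ℂ (StrongDual ℂ E)) : TranslationBound (F := V) (X.subEmb V) τ C := by
  intro h f f' hf
  have h1 : X.dualEmb f'.1 = X.dualEmb (X.dualTransl h f.1) :=
    hf.trans (X.dualEmb_dualTransl h f.1).symm
  have h2 := X.dualWeight_le_of_bound hC hb (-h)
  rw [norm_neg] at h2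
  change ‖f'.1‖ ≤ C * ‖f.1‖ * Real.exp (W.assoc (τ * ‖h‖))
  rw [X.dualEmb_injective h1]
  calc _ ≤ X.dualWeight (-h) * ‖f.1‖ := X.norm_dualTransl_le h f.1
    _ ≤ C * Real.exp (W.assoc (τ * ‖h‖)) * ‖f.1‖ := by gcongr
    _ = _ := by ring

theorem axiomIII_subEmb (V : Submodule ℂ (StrongDual ℂ E)) :
    AxiomIII (F := V) (X.subEmb V) := by
  have := X.axiomIII
  cases c with
  | beurling =>
    obtain ⟨τ, hτ, C, hC, hb⟩ := this
    exact ⟨τ, hτ, C, hC, X.translationBound_subEmb hC.le hb V⟩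
  | roumieu =>
    intro τ hτ
    obtain ⟨C, hC, hb⟩ := this τ hτ
    exact ⟨C, hC, X.translationBound_subEmb hC.le hb V⟩

/-! ### The reflexive case -/

theorem strongContSubmodule_eq_top
    (hE : Function.Surjective (NormedSpace.inclusionInDoubleDual ℂ E)) :
    X.strongContSubmodule = ⊤ := by
  by_contra hne
  obtain ⟨f, -, hf⟩ := SetLike.exists_of_lt (lt_top_iff_ne_top.2 hne)
  obtain ⟨Φ, hΦf, hΦ⟩ := exists_dual_of_notMem X.isClosed_strongCont hf
  obtain ⟨g, hg⟩ := hE Φ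
  have hg' : ∀ k : StrongDual ℂ E, k g = Φ k := fun k => by
    rw [← NormedSpace.dual_def ℂ E g k, hg]
  have hg0 : g = 0 := by
    refine X.emb_injective ?_
    rw [map_zero]
    ext φ
    rw [← dualIncl_apply, hg', hΦ _ (X.dualIncl_mem φ)]
    rfl
  rw [← hg', hg0, map_zero] at hΦf
  exact hΦf rfl

end TISpace

end UltraTI
end

theorem mainTheorem6 (d : ℕ) (W : UltraTI.WeightPair) (c : UltraTI.UltraCase)
    (E : Type*) [NormedAddCommGroup E] [NormedSpace ℂ E] [CompleteSpace E]
    (X : UltraTI.TISpace W c d E) :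
    ∃ V : Submodule ℂ (StrongDual ℂ E),
      (V : Set (StrongDual ℂ E)) = X.goodDual ∧
      IsClosed (V : Set (StrongDual ℂ E)) ∧
      UltraTI.AxiomA' (F := V) (X.subEmb V) ∧
      UltraTI.AxiomIIStrong (F := V) (X.subEmb V) ∧
      UltraTI.AxiomIII (F := V) (X.subEmb V) ∧
      X.IsBanachModule V ∧
      (∀ φ : UltraTI.TestSpace W c d,
        ∃ u : ℝ → UltraTI.beurlingL1 X.dualWeight,
          (∀ ε : ℝ, 0 < ε → (u ε : UltraTI.Rd d → ℂ) = UltraTI.mollifier φ ε) ∧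
          ∀ f ∈ V, Filter.Tendsto
            (fun ε => ‖(∫ x, φ x) • f - X.dualConv (u ε) f‖)
            (nhdsWithin 0 (Set.Ioi 0)) (nhds 0)) ∧
      (Function.Surjective (NormedSpace.inclusionInDoubleDual ℂ E) → V = ⊤) :=
  ⟨X.strongContSubmodule, X.coe_strongContSubmodule, X.isClosed_strongCont,
    X.axiomA'_strongContSubmodule, X.axiomIIStrong_strongContSubmodule, X.axiomIII_subEmb _,
    X.isBanachModule_strongContSubmodule, X.exists_mollifier_tendsto,
    X.strongContSubmodule_eq_top⟩
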